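/- Let $n\ge 0$ and let $\Lambda\mathbb R^n$ be the exterior algebra of $\mathbb R^n$ with the inner product induced from $\mathbb R^n$ (the one for which the products $e_{i_1}\wedge\dots\wedge e_{i_k}$, $i_1<\dots<i_k$, of the standard basis vectors are orthonormal). Let $d=\sum_i e_i\wedge\partial_i$ be the exterior derivative, let $\delta=-d^*=\sum_i e_i\lrcorner\,\partial_i$ be the interior derivative (the negative of the formal adjoint of $d$), and put $\mathcal D^{\pm}=d\pm\delta$, with derivatives taken in the weak sense. Let $\Omega\subset\mathbb R^n$ be a bounded open set (for example a bounded domain), and let $\mathcal M\in L^\infty(\Omega,\mathcal L(\Lambda\mathbb R^n))$ satisfy $\operatorname{ess\,sup}_{x\in\Omega}\|\mathcal M(x)\|<1$, where $\|\cdot\|$ is the operator norm. Let $(F_j)_{j\ge 0}$ be a sequence in $W^{1,2}_{\mathrm{loc}}(\Omega,\Lambda\mathbb R^n)$ such that every $F_j$ solves the Dirac–Beltrami equation $$\mathcal D^-F(x)=\mathcal M(x)\,\mathcal D^+F(x)\qquad\text{for a.e. }x\in\Omega,$$ and suppose that $(F_j)$ is locally bounded in $L^2$, i.e. $\sup_j\|F_j\|_{L^2(K)}<\infty$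 for every compact $K\subset\Omega$. Then for every open set $U$ whose closure is compact and contained in $\Omega$ (in particular for every such $U$ with smooth boundary) there are a subsequence $(F_{j_k})_k$ and a function $F_U\in W^{1,2}(U,\Lambda\mathbb R^n)$ such that $F_{j_k}|_U\to F_U$ in $W^{1,2}(U,\Lambda\mathbb R^n)$ and $\mathcal D^-F_U=\mathcal M\,\mathcal D^+F_U$ a.e. in $U$. -/

import Mathlib

open MeasureTheory Filter Topology
open scoped ENNReal NNReal ContDiff

noncomputable section

namespace DiracBeltrami

/-- Euclidean space `ℝⁿ`. -/
abbrev Eucl (n : ℕ) : Type := EuclideanSpace ℝ (Fin n)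

/-- The full exterior algebra `Λℝⁿ`. -/
abbrev Ext (n : ℕ) : Type := ExteriorAlgebra ℝ (Eucl n)

/-- The standard basis vector `e i` of `ℝⁿ`. -/
def e {n : ℕ} (i : Fin n) : Eucl n := EuclideanSpace.single i 1

/-- The basis `e_S = e_{i₁} ∧ ⋯ ∧ e_{i_k}` (`S = {i₁ < ⋯ < i_k}`) of `Λℝⁿ`. -/
def extBasis (n : ℕ) : Module.Basis (Finset (Fin n)) ℝ (Ext n) :=
  (EuclideanSpace.basisFun (Fin n) ℝ).toBasis.ExteriorAlgebra

/-- The inner product of `Λℝⁿ` induced from `ℝⁿ`: the one for which the `e_S` are orthonormal. -/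
instance extCore (n : ℕ) : InnerProductSpace.Core ℝ (Ext n) where
  inner x y := ∑ S, (extBasis n).repr x S * (extBasis n).repr y S
  conj_inner_symm x y := by simp [mul_comm]
  add_left x y z := by simp [add_mul, Finset.sum_add_distrib]
  smul_left x y r := by simp [Finset.mul_sum, mul_assoc]
  re_inner_nonneg x := by
    simpa using Finset.sum_nonneg (fun S _ => mul_self_nonneg ((extBasis n).repr x S))
  definite x h := by
    rw [Finset.sum_eq_zero_iff_of_nonneg (fun S _ => mul_self_nonneg _)] at h
    apply (extBasis n).ext_elem
    simpa using h

instance extNormedAddCommGroup (n : ℕ) : NormedAddCommGroup (Ext n) :=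
  InnerProductSpace.Core.toNormedAddCommGroup (𝕜 := ℝ)

instance extInnerProductSpace (n : ℕ) : InnerProductSpace ℝ (Ext n) :=
  InnerProductSpace.ofCore _

instance extFiniteDimensional (n : ℕ) : FiniteDimensional ℝ (Ext n) :=
  (extBasis n).finiteDimensional_of_finite

/-- Left exterior multiplication `x ↦ e i ∧ x`. -/
def wedge {n : ℕ} (i : Fin n) (x : Ext n) : Ext n := ExteriorAlgebra.ι ℝ (e i) * x

/-- Left interior multiplication (contraction) `x ↦ e i ⌟ x`. -/
def contract {n : ℕ} (i : Fin n) (x : Ext n) : Ext n :=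
  CliffordAlgebra.contractLeft (Q := (0 : QuadraticForm ℝ (Eucl n))) (innerₗ (Eucl n) (e i)) x

/-- Contraction is an antiderivation. -/
theorem contract_wedge {n : ℕ} (i j : Fin n) (x : Ext n) :
    contract i (wedge j x) = (if i = j then x else 0) - wedge j (contract i x) := by
  have h := CliffordAlgebra.contractLeft_ι_mul (Q := (0 : QuadraticForm ℝ (Eucl n)))
    (innerₗ (Eucl n) (e i)) (e j) x
  have h2 : innerₗ (Eucl n) (e i) (e j) = if i = j then 1 else 0 := by
    simp [e, EuclideanSpace.inner_single_left]
  rw [h2, ite_smul, one_smul, zero_smul] at h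
  exact h

theorem contract_one {n : ℕ} (i : Fin n) : contract i (1 : Ext n) = 0 :=
  CliffordAlgebra.contractLeft_one _ _

/-- `pairing x y` is the scalar part of the iterated contraction of `y` by `x`. -/
def pairing {n : ℕ} : Ext n →ₗ[ℝ] Ext n →ₗ[ℝ] ℝ :=
  (LinearMap.llcomp ℝ (Ext n) (Ext n) ℝ ExteriorAlgebra.algebraMapInv.toLinearMap) ∘ₗ
    (MulOpposite.opLinearEquiv ℝ).symm.toLinearMap ∘ₗ
    (ExteriorAlgebra.lift ℝ (A := (Module.End ℝ (Ext n))ᵐᵒᵖ)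
      ⟨(MulOpposite.opLinearEquiv ℝ).toLinearMap ∘ₗ
        CliffordAlgebra.contractLeft (Q := (0 : QuadraticForm ℝ (Eucl n))) ∘ₗ innerₗ (Eucl n),
        fun _ => MulOpposite.unop_injective <| LinearMap.ext fun x =>
          CliffordAlgebra.contractLeft_contractLeft _ x⟩).toLinearMap

theorem pairing_wedge {n : ℕ} (i : Fin n) (x y : Ext n) :
    pairing (wedge i x) y = pairing x (contract i y) := by
  simp [pairing, wedge, contract]

theorem pairing_one {n : ℕ} (y : Ext n) :
    pairing 1 y = ExteriorAlgebra.algebraMapInv y := by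
  simp [pairing]

/-- The product `e_{i₁} ∧ ⋯ ∧ e_{i_k}` over a list of indices. -/
def wedgeList {n : ℕ} : List (Fin n) → Ext n
  | [] => 1
  | i :: l => wedge i (wedgeList l)

theorem contract_wedge_zero {n : ℕ} {i : Fin n} {l : List (Fin n)} (h : i ∉ l) :
    contract i (wedgeList l) = 0 := by
  induction l with
  | nil => exact contract_one i
  | cons j l ih =>
    rw [List.mem_cons, not_or] at h
    rw [wedgeList, contract_wedge, if_neg h.1, ih h.2, wedge, mul_zero, sub_zero]

theorem pairing_wedgeList_wedge {n : ℕ} {j : Fin n} {l : List (Fin n)} (h : j ∉ l) (y : Ext n) :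
    pairing (wedgeList l) (wedge j y) = 0 := by
  induction l generalizing y with
  | nil => simp [wedgeList, pairing_one, wedge, ExteriorAlgebra.algebraMapInv]
  | cons i l ih =>
    rw [List.mem_cons, not_or] at h
    rw [wedgeList, pairing_wedge, contract_wedge, if_neg (Ne.symm h.1), zero_sub, map_neg,
      ih h.2, neg_zero]

theorem pairing_wedgeList {n : ℕ} {l m : List (Fin n)} (hl : l.Pairwise (· < ·))
    (hm : m.Pairwise (· < ·)) :
    pairing (wedgeList l) (wedgeList m) = if l = m then 1 else 0 := by
  induction l generalizing m with
  | nil =>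
    cases m with
    | nil => simp [wedgeList, pairing_one]
    | cons j m => exact pairing_wedgeList_wedge (l := []) (by simp) (wedgeList m)
  | cons i l ih =>
    rw [List.pairwise_cons] at hl
    cases m with
    | nil => simp [wedgeList, pairing_wedge, contract_one]
    | cons j m =>
      have hm' := hm
      rw [List.pairwise_cons] at hm
      rcases lt_trichotomy i j with h | h | h
      · have hi : i ∉ j :: m := by
          rw [List.mem_cons]
          rintro (h1 | h1)
          · exact h.ne h1
          · exact lt_asymm h (hm.1 i h1)
        rw [wedgeList, pairing_wedge, contract_wedge_zero hi, map_zero,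
          if_neg (fun h' => h.ne (List.cons.inj h').1)]
      · subst h
        have hi : i ∉ m := fun h1 => lt_irrefl _ (hm.1 i h1)
        rw [wedgeList, pairing_wedge, wedgeList, contract_wedge, if_pos rfl,
          contract_wedge_zero hi, wedge, mul_zero, sub_zero, ih hl.2 hm.2]
        simp
      · have hj : j ∉ i :: l := by
          rw [List.mem_cons]
          rintro (h1 | h1)
          · exact h.ne h1
          · exact lt_asymm h (hl.1 j h1)
        rw [show wedgeList (j :: m) = wedge j (wedgeList m) from rfl,
          pairing_wedgeList_wedge hj, if_neg (fun h' => h.ne' (List.cons.inj h').1)]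

theorem extBasis_eq {n : ℕ} (S : Finset (Fin n)) :
    extBasis n S = wedgeList (S.sort (· ≤ ·)) := by
  have key : ∀ l : List (Fin n), wedgeList l = (l.map fun i => ExteriorAlgebra.ι ℝ (e i)).prod := by
    intro l
    induction l with
    | nil => rfl
    | cons i l ih => simp [wedgeList, wedge, ih]
  rw [key, extBasis, ExteriorAlgebra.basis_apply_ofCard _ (rfl : S.card = S.card)]
  simp only [ExteriorAlgebra.ιMulti_family, ExteriorAlgebra.ιMulti_apply]
  congr 1
  apply List.ext_getElem
  · simp
  · intro k h1 h2
    simp only [List.getElem_ofFn, List.getElem_map, Function.comp]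
    have hb : ∀ i, (EuclideanSpace.basisFun (Fin n) ℝ).toBasis i = e i := fun i => by simp [e]
    refine congrArg _ ((hb _).trans ?_)
    rfl

theorem pairing_eq_inner {n : ℕ} (x y : Ext n) : pairing x y = inner ℝ x y := by
  have h : ∀ S T, pairing (extBasis n S) (extBasis n T) = if S = T then 1 else 0 := by
    intro S T
    rw [extBasis_eq, extBasis_eq, pairing_wedgeList (S.sortedLT_sort).pairwise
      (T.sortedLT_sort).pairwise]
    congr 1
    exact propext ⟨fun h => by simpa using congrArg List.toFinset h, fun h => h ▸ rfl⟩
  change _ = ∑ S, (extBasis n).repr x S * (extBasis n).repr y S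
  conv_lhs => rw [← (extBasis n).sum_repr x, ← (extBasis n).sum_repr y]
  simp only [map_sum, map_smul, LinearMap.sum_apply, LinearMap.smul_apply, h, smul_eq_mul]
  refine Finset.sum_congr rfl fun S _ => ?_
  simp [mul_comm]

/-- For the induced inner product, contraction by `e i` is the adjoint of `e i ∧ ·`. -/
theorem inner_wedge_left {n : ℕ} (i : Fin n) (x y : Ext n) :
    inner ℝ (wedge i x) y = inner ℝ x (contract i y) := by
  rw [← pairing_eq_inner, ← pairing_eq_inner, pairing_wedge]

/-- `G` is the weak partial derivative `∂ᵢF` on the open set `Ω`. -/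
def HasWeakPartial {n : ℕ} (Ω : Set (Eucl n)) (i : Fin n) (F G : Eucl n → Ext n) : Prop :=
  LocallyIntegrableOn F Ω ∧ LocallyIntegrableOn G Ω ∧
    ∀ φ : Eucl n → ℝ, ContDiff ℝ ∞ φ → HasCompactSupport φ → tsupport φ ⊆ Ω →
      ∫ x in Ω, fderiv ℝ φ x (e i) • F x = -∫ x in Ω, φ x • G x

open Classical in
/-- The weak partial derivative `∂ᵢF` on `Ω` (unique up to null sets; `0` if there is none). -/
def weakPartial {n : ℕ} (Ω : Set (Eucl n)) (i : Fin n) (F : Eucl n → Ext n) : Eucl n → Ext n :=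
  if h : ∃ G, HasWeakPartial Ω i F G then h.choose else 0

/-- `F ∈ W^{1,2}(Ω, Λℝⁿ)`. -/
def MemW12 {n : ℕ} (Ω : Set (Eucl n)) (F : Eucl n → Ext n) : Prop :=
  MemLp F 2 (volume.restrict Ω) ∧
    ∀ i, ∃ G, HasWeakPartial Ω i F G ∧ MemLp G 2 (volume.restrict Ω)

/-- `F ∈ W^{1,2}_loc(Ω, Λℝⁿ)`: `F` and its weak partial derivatives are in `L²(K)` for every
compact `K ⊆ Ω`. -/
def MemW12Loc {n : ℕ} (Ω : Set (Eucl n)) (F : Eucl n → Ext n) : Prop :=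
  (∀ K ⊆ Ω, IsCompact K → MemLp F 2 (volume.restrict K)) ∧
    ∀ i, ∃ G, HasWeakPartial Ω i F G ∧ ∀ K ⊆ Ω, IsCompact K → MemLp G 2 (volume.restrict K)

/-- The norm of `W^{1,2}(Ω, Λℝⁿ)`, `(‖F‖² + ∑ᵢ ‖∂ᵢF‖²)^{1/2}` with `L²(Ω)` norms. -/
def w12Norm {n : ℕ} (Ω : Set (Eucl n)) (F : Eucl n → Ext n) : ℝ≥0∞ :=
  (eLpNorm F 2 (volume.restrict Ω) ^ 2 +
    ∑ i, eLpNorm (weakPartial Ω i F) 2 (volume.restrict Ω) ^ 2) ^ (1 / 2 : ℝ)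

/-- Convergence `F_k → G` in `W^{1,2}(Ω, Λℝⁿ)`. -/
def TendstoW12 {n : ℕ} (Ω : Set (Eucl n)) (F : ℕ → Eucl n → Ext n) (G : Eucl n → Ext n) : Prop :=
  (∀ k, MemW12 Ω (F k)) ∧ MemW12 Ω G ∧ Tendsto (fun k => w12Norm Ω (F k - G)) atTop (𝓝 0)

/-- The exterior derivative `dF = ∑ᵢ eᵢ ∧ ∂ᵢF`. -/
def extD {n : ℕ} (Ω : Set (Eucl n)) (F : Eucl n → Ext n) (x : Eucl n) : Ext n :=
  ∑ i, wedge i (weakPartial Ω i F x)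

/-- The interior derivative `δF = ∑ᵢ eᵢ ⌟ ∂ᵢF`. As `eᵢ ⌟ ·` is the adjoint of `eᵢ ∧ ·`, an
integration by parts shows that `δ = -d*`. -/
def intD {n : ℕ} (Ω : Set (Eucl n)) (F : Eucl n → Ext n) (x : Eucl n) : Ext n :=
  ∑ i, contract i (weakPartial Ω i F x)

/-- The Hodge-Dirac operator `𝒟⁺ = d + δ`. -/
def diracPlus {n : ℕ} (Ω : Set (Eucl n)) (F : Eucl n → Ext n) (x : Eucl n) : Ext n :=
  extD Ω F x + intD Ω F x

/-- The Hodge-Dirac operator `𝒟⁻ = d - δ`. -/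
def diracMinus {n : ℕ} (Ω : Set (Eucl n)) (F : Eucl n → Ext n) (x : Eucl n) : Ext n :=
  extD Ω F x - intD Ω F x

/-- The Dirac-Beltrami equation `𝒟⁻F = 𝓜 𝒟⁺F` almost everywhere on `Ω`. -/
def SolvesDiracBeltrami {n : ℕ} (Ω : Set (Eucl n)) (M : Eucl n → Ext n →L[ℝ] Ext n)
    (F : Eucl n → Ext n) : Prop :=
  ∀ᵐ x ∂volume.restrict Ω, diracMinus Ω F x = M x (diracPlus Ω F x)

/-- Boundedness of the sequence `F` in `L²(K)` for every compact `K ⊆ Ω`. -/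
def LocallyBoundedL2 {n : ℕ} (Ω : Set (Eucl n)) (F : ℕ → Eucl n → Ext n) : Prop :=
  ∀ K ⊆ Ω, IsCompact K → ∃ C : ℝ≥0, ∀ j, eLpNorm (F j) 2 (volume.restrict K) ≤ C

end DiracBeltrami

end

namespace DiracBeltrami

open FourierTransform

/-! The symbols `e_i ∧ · ± e_i ⌟ ·` satisfy Clifford relations and are self-adjoint for `𝒟⁺`,
skew-adjoint for `𝒟⁻`. Hence both operators preserve Dirichlet energy on cut-off functions: `∫ |𝒟^±
G|² = ∫ |∇G|²` (`IsWeakGrad.integral_norm_sq_dirac`). For a cutoff `φ` and a solution `F`, `𝒟⁻(φF)`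
equals `𝓜 𝒟⁺(φF)` up to an error of size `|∇φ||F|`. Since `‖𝓜‖ ≤ κ < 1` and the two energies agree,
the main term is absorbed. This gives Caccioppoli's inequality `‖∇(φF)‖ ≤ C ‖F‖_{L²(supp φ)}` with
`C` independent of `F` (`exists_caccioppoli`).

The inequality is used twice. Applied to the `F_j` it bounds their gradients locally, so Rellich's
theorem (`exists_subseq_tendsto_eLpNorm_sub`) yields a subsequence that is Cauchy in `L²` on a
smaller compact set. The equation is linear, so differences of solutions are solutions; applied to
these, the inequality makes the gradients Cauchy on `U` as well. Weak derivatives and the equation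
survive strong `L²` limits.

The energy identity and Rellich's theorem are both proved on the Fourier side, where a weak
derivative becomes multiplication by `2πi ξ_i`. No second derivatives or approximation by smooth
functions are needed. -/

/-! ### Plancherel's theorem on `L¹ ∩ L²` -/

/-- Both transforms act in the same way on test functions: the `L²` one because it agrees with the
distributional transform, the integral one by Fubini. Locally integrable functions with the same
pairings agree almost everywhere. -/
theorem fourier_toLp_ae_eq {n : ℕ} {g : Eucl n → ℂ} (h1 : Integrable g) (h2 : MemLp g 2) :
    (𝓕 (h2.toLp g) : Lp ℂ 2 (volume : Measure (Eucl n))) =ᵐ[volume] 𝓕 g := by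
  have hcont : Continuous (𝓕 g) :=
    VectorFourier.fourierIntegral_continuous Real.continuous_fourierChar
      (by exact continuous_inner) h1
  have hL := (Lp.memLp (𝓕 (h2.toLp g) : Lp ℂ 2 (volume : Measure (Eucl n)))).locallyIntegrable
    (by norm_num)
  have key := ae_eq_zero_of_integral_contDiff_smul_eq_zero (μ := (volume : Measure (Eucl n)))
    (hL.sub hcont.locallyIntegrable) (fun φ hφ hc => ?_)
  · filter_upwards [key] with x hx
    exact sub_eq_zero.1 hx
  have hg₁ : HasCompactSupport (Complex.ofRealCLM ∘ φ) := hc.comp_left rfl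
  have hg₂ : ContDiff ℝ ∞ (Complex.ofRealCLM ∘ φ) := by fun_prop
  have hi : ∀ {u : Eucl n → ℂ}, LocallyIntegrable u → Integrable (fun x => φ x • u x) :=
    fun hu => hu.integrable_smul_left_of_hasCompactSupport hφ.continuous hc
  simp only [Pi.sub_apply, smul_sub]
  rw [integral_sub (hi hL) (hi hcont.locallyIntegrable), sub_eq_zero]
  have e1 := congrArg (fun T => T (hg₁.toSchwartzMap hg₂))
    (Lp.fourier_toTemperedDistribution_eq (h2.toLp g))
  simp only [TemperedDistribution.fourier_apply, Lp.toTemperedDistribution_apply] at e1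
  have e2 : ∀ u : Eucl n → ℂ, (∫ x, (hg₁.toSchwartzMap hg₂) x • u x) = ∫ x, φ x • u x := by
    intro u
    simp
  rw [e2] at e1
  rw [← e1, ← e2 (𝓕 g)]
  have e3 : ∫ x, 𝓕 (⇑(hg₁.toSchwartzMap hg₂)) x • g x =
      ∫ x, (hg₁.toSchwartzMap hg₂) x • 𝓕 g x := by
    simpa using! VectorFourier.integral_fourierIntegral_smul_eq_flip (L := innerₗ (Eucl n))
      Real.continuous_fourierChar continuous_inner (hg₁.toSchwartzMap hg₂).integrable h1
  rw [← e3]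
  refine integral_congr_ae ?_
  filter_upwards [h2.coeFn_toLp] with x hx
  rw [hx, SchwartzMap.fourier_coe]

theorem memLp_fourier {n : ℕ} {g : Eucl n → ℂ} (h1 : Integrable g) (h2 : MemLp g 2) :
    MemLp (𝓕 g) 2 :=
  (memLp_congr_ae (fourier_toLp_ae_eq h1 h2)).1 (Lp.memLp _)

/-- Plancherel's theorem for integrable and square-integrable functions. -/
theorem integral_inner_fourier {n : ℕ} {f g : Eucl n → ℂ} (hf1 : Integrable f) (hf2 : MemLp f 2)
    (hg1 : Integrable g) (hg2 : MemLp g 2) :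
    ∫ ξ, inner ℂ (𝓕 f ξ) (𝓕 g ξ) = ∫ x, inner ℂ (f x) (g x) := by
  have h := Lp.inner_fourier_eq (hf2.toLp f) (hg2.toLp g)
  rw [L2.inner_def, L2.inner_def] at h
  calc _ = _ := integral_congr_ae ?_
    _ = _ := h
    _ = _ := integral_congr_ae ?_
  · filter_upwards [fourier_toLp_ae_eq hf1 hf2, fourier_toLp_ae_eq hg1 hg2] with x hx hy
    rw [hx, hy]
  · filter_upwards [hf2.coeFn_toLp, hg2.coeFn_toLp] with x hx hy
    rw [hx, hy]

theorem integral_norm_sq_fourier {n : ℕ} {f : Eucl n → ℂ} (hf1 : Integrable f)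
    (hf2 : MemLp f 2) : ∫ ξ, ‖𝓕 f ξ‖ ^ 2 = ∫ x, ‖f x‖ ^ 2 := by
  have h := integral_inner_fourier hf1 hf2 hf1 hf2
  simp only [inner_self_eq_norm_sq_to_K] at h
  have e : ∀ u : Eucl n → ℂ, ∫ x, ((‖u x‖ : ℂ)) ^ 2 = ((∫ x, ‖u x‖ ^ 2 : ℝ) : ℂ) := by
    intro u
    rw [← integral_complex_ofReal]
    simp
  erw [e, e] at h
  exact_mod_cast h

/-! ### Weak gradients and the Fourier transform -/

/-- `G'` is the weak gradient of `G` on `ℝⁿ`, both being integrable and square-integrable, where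
bounded smooth functions are admitted as test functions. -/
structure IsWeakGrad {n : ℕ} {H : Type*} [NormedAddCommGroup H] [InnerProductSpace ℝ H]
    (G : Eucl n → H) (G' : Fin n → Eucl n → H) : Prop where
  integrable : Integrable G
  memLp : MemLp G 2
  integrable_grad : ∀ i, Integrable (G' i)
  memLp_grad : ∀ i, MemLp (G' i) 2
  integral_eq : ∀ i, ∀ ψ : Eucl n → ℝ, ContDiff ℝ ∞ ψ →
    (∃ C, ∀ x, ‖ψ x‖ ≤ C) → (∃ C, ∀ x, ‖fderiv ℝ ψ x (e i)‖ ≤ C) →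
    ∫ x, fderiv ℝ ψ x (e i) • G x = -∫ x, ψ x • G' i x

/-- Test functions for weak gradients are real, so the character is split into two real bounded
functions. -/
theorem fourier_eq_cos_sub_sin {n : ℕ} {g : Eucl n → ℂ} (hg : Integrable g) (ξ : Eucl n) :
    𝓕 g ξ = (∫ x, Real.cos (2 * Real.pi * inner ℝ x ξ) • g x) -
      Complex.I * ∫ x, Real.sin (2 * Real.pi * inner ℝ x ξ) • g x := by
  have mc : Continuous (fun x : Eucl n => Real.cos (2 * Real.pi * inner ℝ x ξ)) := by fun_prop
  have ms : Continuous (fun x : Eucl n => Real.sin (2 * Real.pi * inner ℝ x ξ)) := by fun_prop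
  have hc : Integrable (fun x => Real.cos (2 * Real.pi * inner ℝ x ξ) • g x) :=
    hg.bdd_smul 1 mc.aestronglyMeasurable (ae_of_all _ fun x => Real.abs_cos_le_one _)
  have hs : Integrable (fun x => Real.sin (2 * Real.pi * inner ℝ x ξ) • g x) :=
    hg.bdd_smul 1 ms.aestronglyMeasurable (ae_of_all _ fun x => Real.abs_sin_le_one _)
  rw [Real.fourier_eq', ← integral_const_mul, ← integral_sub hc (hs.const_mul _)]
  refine integral_congr_ae (ae_of_all _ fun x => ?_)
  simp only [Complex.exp_mul_I, smul_eq_mul, Complex.real_smul]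
  rw [show ((-2 * Real.pi * inner ℝ x ξ : ℝ) : ℂ) = -((2 * Real.pi * inner ℝ x ξ : ℝ) : ℂ) by
    push_cast; ring, Complex.cos_neg, Complex.sin_neg, Complex.ofReal_cos, Complex.ofReal_sin]
  ring

/-- The cosine and sine of `2π⟨x, ξ⟩` are bounded with bounded derivatives but not compactly
supported; this is why `IsWeakGrad` admits bounded test functions. -/
theorem fourier_weakGrad {n : ℕ} {g : Eucl n → ℂ} {g' : Fin n → Eucl n → ℂ}
    (h : IsWeakGrad g g') (i : Fin n) (ξ : Eucl n) :
    𝓕 (g' i) ξ = (2 * Real.pi * ξ i : ℝ) * Complex.I * 𝓕 g ξ := by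
  set θ : Eucl n → ℝ := fun x => 2 * Real.pi * inner ℝ x ξ with hθ
  have hθd : ∀ x, HasFDerivAt θ ((2 * Real.pi) • (innerSL ℝ ξ)) x := by
    intro x
    have := ((innerSL ℝ ξ).hasFDerivAt (x := x)).const_mul (2 * Real.pi)
    simpa [hθ, real_inner_comm] using this
  have hθs : ContDiff ℝ ∞ θ := contDiff_const.mul (contDiff_id.inner ℝ contDiff_const)
  have hei : inner ℝ ξ (e i) = ξ i := by simp [e, EuclideanSpace.inner_single_right]
  have dc : ∀ x, fderiv ℝ (fun x => Real.cos (θ x)) x (e i) =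
      -(2 * Real.pi * ξ i) * Real.sin (θ x) := by
    intro x
    rw [(hθd x).cos.fderiv]
    simp [hei]; ring
  have ds : ∀ x, fderiv ℝ (fun x => Real.sin (θ x)) x (e i) =
      (2 * Real.pi * ξ i) * Real.cos (θ x) := by
    intro x
    rw [(hθd x).sin.fderiv]
    simp [hei]; ring
  have hC : ∀ a b : ℝ, |b| ≤ 1 → ‖a * b‖ ≤ |a| := fun a b hb => by
    rw [norm_mul]; exact mul_le_of_le_one_right (abs_nonneg _) hb
  have ic := h.integral_eq i (fun x => Real.cos (θ x)) (by fun_prop)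
    ⟨1, fun x => Real.abs_cos_le_one _⟩
    ⟨_, fun x => by rw [dc]; exact hC _ _ (Real.abs_sin_le_one _)⟩
  have is := h.integral_eq i (fun x => Real.sin (θ x)) (by fun_prop)
    ⟨1, fun x => Real.abs_sin_le_one _⟩
    ⟨_, fun x => by rw [ds]; exact hC _ _ (Real.abs_cos_le_one _)⟩
  simp only [dc, mul_smul, integral_smul] at ic
  simp only [ds, mul_smul, integral_smul] at is
  rw [fourier_eq_cos_sub_sin (h.integrable_grad i), fourier_eq_cos_sub_sin h.integrable,
    ← neg_eq_iff_eq_neg.2 ic, ← neg_eq_iff_eq_neg.2 is]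
  change _ = _ * _ * ((∫ x, Real.cos (θ x) • g x) - Complex.I * ∫ x, Real.sin (θ x) • g x)
  generalize (∫ x, Real.cos (θ x) • g x) = a
  generalize (∫ x, Real.sin (θ x) • g x) = b
  simp only [Complex.real_smul]
  push_cast
  linear_combination (2 * Real.pi * ξ i * b) * Complex.I_sq

/-! ### Energy identity for Dirac operators -/

section IsWeakGrad

variable {n : ℕ} {H : Type*} [NormedAddCommGroup H] [InnerProductSpace ℝ H]
  {H' : Type*} [NormedAddCommGroup H'] [InnerProductSpace ℝ H'] [CompleteSpace H']
  {G G₂ : Eucl n → H} {G' G₂' : Fin n → Eucl n → H}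

theorem IsWeakGrad.clm [CompleteSpace H] (h : IsWeakGrad G G') (L : H →L[ℝ] H') :
    IsWeakGrad (fun x => L (G x)) (fun i x => L (G' i x)) where
  integrable := L.integrable_comp h.integrable
  memLp := L.comp_memLp' h.memLp
  integrable_grad i := L.integrable_comp (h.integrable_grad i)
  memLp_grad i := L.comp_memLp' (h.memLp_grad i)
  integral_eq i ψ hψ hb hb' := by
    obtain ⟨C, hC⟩ := hb
    obtain ⟨C', hC'⟩ := hb'
    have c' : Continuous (fun x => fderiv ℝ ψ x (e i)) :=
      (hψ.continuous_fderiv (by simp)).clm_apply continuous_const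
    simp only [← map_smul]
    rw [L.integral_comp_comm, L.integral_comp_comm,
      h.integral_eq i ψ hψ ⟨C, hC⟩ ⟨C', hC'⟩, map_neg]
    · exact (h.integrable_grad i).bdd_smul C hψ.continuous.aestronglyMeasurable (ae_of_all _ hC)
    · exact h.integrable.bdd_smul C' c'.aestronglyMeasurable (ae_of_all _ hC')

theorem IsWeakGrad.sub (h : IsWeakGrad G G') (h₂ : IsWeakGrad G₂ G₂') :
    IsWeakGrad (G - G₂) (fun i => G' i - G₂' i) where
  integrable := h.integrable.sub h₂.integrable
  memLp := h.memLp.sub h₂.memLp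
  integrable_grad i := (h.integrable_grad i).sub (h₂.integrable_grad i)
  memLp_grad i := (h.memLp_grad i).sub (h₂.memLp_grad i)
  integral_eq i ψ hψ hb hb' := by
    have e1 := h.integral_eq i ψ hψ hb hb'
    have e2 := h₂.integral_eq i ψ hψ hb hb'
    obtain ⟨C, hC⟩ := hb
    obtain ⟨C', hC'⟩ := hb'
    have c' : Continuous (fun x => fderiv ℝ ψ x (e i)) :=
      (hψ.continuous_fderiv (by simp)).clm_apply continuous_const
    simp only [Pi.sub_apply, smul_sub]
    rw [integral_sub, integral_sub, e1, e2]
    · abel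
    · exact (h.integrable_grad i).bdd_smul C hψ.continuous.aestronglyMeasurable (ae_of_all _ hC)
    · exact (h₂.integrable_grad i).bdd_smul C hψ.continuous.aestronglyMeasurable (ae_of_all _ hC)
    · exact h.integrable.bdd_smul C' c'.aestronglyMeasurable (ae_of_all _ hC')
    · exact h₂.integrable.bdd_smul C' c'.aestronglyMeasurable (ae_of_all _ hC')

theorem integrable_inner_of_memLp {𝕜 E α : Type*} [RCLike 𝕜] [NormedAddCommGroup E]
    [InnerProductSpace 𝕜 E] [MeasurableSpace α] {μ : Measure α} {f g : α → E} (hf : MemLp f 2 μ)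
    (hg : MemLp g 2 μ) : Integrable (fun x => inner 𝕜 (f x) (g x)) μ := by
  refine (hf.norm.integrable_mul hg.norm).mono
    (hf.aestronglyMeasurable.inner hg.aestronglyMeasurable) (ae_of_all _ fun x => ?_)
  simpa using norm_inner_le_norm (𝕜 := 𝕜) (f x) (g x)

/-- By Plancherel both sides integrate `4π² ξ_i ξ_j` times the pairing of the two transforms, which
is symmetric in `i` and `j`. -/
theorem integral_inner_weakGrad_swap_complex {f g : Eucl n → ℂ} {f' g' : Fin n → Eucl n → ℂ}
    (hf : IsWeakGrad f f') (hg : IsWeakGrad g g') (i j : Fin n) :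
    ∫ x, inner ℂ (f' i x) (g' j x) = ∫ x, inner ℂ (f' j x) (g' i x) := by
  rw [← integral_inner_fourier (hf.integrable_grad i) (hf.memLp_grad i) (hg.integrable_grad j)
    (hg.memLp_grad j), ← integral_inner_fourier (hf.integrable_grad j) (hf.memLp_grad j)
    (hg.integrable_grad i) (hg.memLp_grad i)]
  refine integral_congr_ae (ae_of_all _ fun ξ => ?_)
  simp only [fourier_weakGrad hf, fourier_weakGrad hg, RCLike.inner_apply, map_mul,
    Complex.conj_ofReal, Complex.conj_I]
  push_cast
  ring

variable [FiniteDimensional ℝ H]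

/-- Weak derivatives commute when integrated against each other. -/
theorem IsWeakGrad.integral_inner_swap (h : IsWeakGrad G G') (A : H →L[ℝ] H) (i j : Fin n) :
    ∫ x, inner ℝ (A (G' i x)) (G' j x) = ∫ x, inner ℝ (A (G' j x)) (G' i x) := by
  set b := stdOrthonormalBasis ℝ H
  set L : Fin (Module.finrank ℝ H) → H →L[ℝ] ℂ := fun s =>
    Complex.ofRealCLM ∘L innerSL ℝ (b s) with hL
  have hLi : ∀ s t x y, inner ℂ (L s x) (L t y) = ((inner ℝ (b s) x * inner ℝ (b t) y : ℝ) : ℂ) := by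
    intro s t x y
    simp [hL, mul_comm]
  -- Expanding in an orthonormal basis reduces the bilinear form to products of scalar components,
  -- for which the complex-valued case applies.
  have key : ∀ x y : H, ((inner ℝ (A x) y : ℝ) : ℂ) =
      ∑ s, ∑ t, ((inner ℝ (A (b s)) (b t) : ℝ) : ℂ) * inner ℂ (L s x) (L t y) := by
    intro x y
    simp only [hLi, ← Complex.ofReal_mul, ← Complex.ofReal_sum]
    congr 1
    conv_lhs => rw [← b.sum_repr' x, ← b.sum_repr' y]
    simp only [map_sum, map_smul, sum_inner]
    refine Finset.sum_congr rfl fun s _ => ?_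
    rw [inner_sum]
    refine Finset.sum_congr rfl fun t _ => ?_
    rw [inner_smul_left, inner_smul_right, conj_trivial]
    ring
  have hint : ∀ s t i j, Integrable (fun x => inner ℂ (L s (G' i x)) (L t (G' j x))) :=
    fun s t i j => integrable_inner_of_memLp ((h.clm (L s)).memLp_grad i)
      ((h.clm (L t)).memLp_grad j)
  have key2 : ∀ i j, ((∫ x, inner ℝ (A (G' i x)) (G' j x) : ℝ) : ℂ) =
      ∑ s, ∑ t, ((inner ℝ (A (b s)) (b t) : ℝ) : ℂ) *
        ∫ x, inner ℂ (L s (G' i x)) (L t (G' j x)) := by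
    intro i j
    rw [← integral_complex_ofReal, integral_congr_ae (ae_of_all _ fun x => key _ _),
      integral_finsetSum _ fun s _ => integrable_finsetSum _ fun t _ => (hint s t i j).const_mul _]
    refine Finset.sum_congr rfl fun s _ => ?_
    rw [integral_finsetSum _ fun t _ => (hint s t i j).const_mul _]
    refine Finset.sum_congr rfl fun t _ => ?_
    rw [integral_const_mul]
  apply Complex.ofReal_injective
  rw [key2, key2]
  refine Finset.sum_congr rfl fun s _ => Finset.sum_congr rfl fun t _ => ?_
  rw [integral_inner_weakGrad_swap_complex (h.clm (L s)) (h.clm (L t))]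

/-- If the `γ i` are (skew-)adjoint and satisfy the Clifford relations, then the Dirac operator
`∑ γ i ∂ᵢ` preserves the Dirichlet energy. -/
theorem IsWeakGrad.integral_norm_sq_dirac (h : IsWeakGrad G G') {γ : Fin n → H →L[ℝ] H} {ε : ℝ}
    (hε : ε * ε = 1) (hadj : ∀ i x y, inner ℝ (γ i x) y = ε * inner ℝ x (γ i y))
    (hanti : ∀ i j x, γ i (γ j x) + γ j (γ i x) = if i = j then (2 * ε) • x else 0) :
    ∫ x, ‖∑ i, γ i (G' i x)‖ ^ 2 = ∑ i, ∫ x, ‖G' i x‖ ^ 2 := by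
  have hm : ∀ (A : H →L[ℝ] H) i, MemLp (fun x => A (G' i x)) 2 := fun A i =>
    A.comp_memLp' (h.memLp_grad i)
  have hint : ∀ i j, Integrable (fun x => inner ℝ (γ i (G' i x)) (γ j (G' j x))) := fun i j =>
    integrable_inner_of_memLp (hm _ i) (hm _ j)
  have hint2 : ∀ (A : H →L[ℝ] H) i j, Integrable (fun x => inner ℝ (A (G' i x)) (G' j x)) :=
    fun A i j => integrable_inner_of_memLp (hm A i) (h.memLp_grad j)
  have e0 : ∫ x, ‖∑ i, γ i (G' i x)‖ ^ 2 =
      ∑ i, ∑ j, ∫ x, inner ℝ (γ i (G' i x)) (γ j (G' j x)) := by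
    simp only [← real_inner_self_eq_norm_sq, sum_inner]
    simp only [inner_sum]
    rw [integral_finsetSum _ fun s _ => integrable_finsetSum _ fun t _ => hint s t]
    exact Finset.sum_congr rfl fun s _ => integral_finsetSum _ fun t _ => hint s t
  have e1 : ∀ i j, ∫ x, inner ℝ (γ i (G' i x)) (γ j (G' j x)) =
      ε * ∫ x, inner ℝ ((γ j ∘L γ i) (G' i x)) (G' j x) := by
    intro i j
    rw [← integral_const_mul]
    refine integral_congr_ae (ae_of_all _ fun x => ?_)
    simp only [ContinuousLinearMap.comp_apply]
    rw [hadj j (γ i (G' i x)), ← mul_assoc, hε, one_mul]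
  -- Relabelling the double sum and then commuting the two derivatives reverses the order of `γ i`
  -- and `γ j`.
  have e2 : ∑ i, ∑ j, ∫ x, inner ℝ (γ i (G' i x)) (γ j (G' j x)) =
      ∑ i, ∑ j, ε * ∫ x, inner ℝ ((γ i ∘L γ j) (G' i x)) (G' j x) := by
    rw [Finset.sum_comm]
    refine Finset.sum_congr rfl fun s _ => Finset.sum_congr rfl fun t _ => ?_
    rw [e1, h.integral_inner_swap]
  have e3 : ∀ i j, (ε * ∫ x, inner ℝ ((γ j ∘L γ i) (G' i x)) (G' j x)) +
      ε * ∫ x, inner ℝ ((γ i ∘L γ j) (G' i x)) (G' j x) =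
      if i = j then 2 * ∫ x, ‖G' i x‖ ^ 2 else 0 := by
    intro i j
    rw [← mul_add, ← integral_add (hint2 _ i j) (hint2 _ i j)]
    simp only [← inner_add_left, ContinuousLinearMap.comp_apply, hanti]
    split_ifs with hij hji hji
    · subst hij
      clear hji
      simp only [inner_smul_left, real_inner_self_eq_norm_sq, integral_const_mul]
      simp only [conj_trivial]
      linear_combination (2 * ∫ x, ‖G' _ x‖ ^ 2) * hε
    · exact absurd hij.symm hji
    · exact absurd hji.symm hij
    · simp
  -- The energy is written once in each order; in the sum the anticommutators appear and only the
  -- diagonal terms remain.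
  have e4 : 2 * ∫ x, ‖∑ i, γ i (G' i x)‖ ^ 2 = 2 * ∑ i, ∫ x, ‖G' i x‖ ^ 2 := by
    rw [two_mul]
    conv_lhs => rw [e0]
    nth_rewrite 2 [e2]
    simp only [e1, ← Finset.sum_add_distrib, e3]
    simp [Finset.mul_sum]
  linarith

end IsWeakGrad

/-! ### Absorption estimate and Rellich compactness -/

theorem sq_eLpNorm_two {α E : Type*} [MeasurableSpace α] {μ : Measure α} [NormedAddCommGroup E]
    {u : α → E} (hu : MemLp u 2 μ) :
    eLpNorm u 2 μ ^ 2 = ENNReal.ofReal (∫ x, ‖u x‖ ^ 2 ∂μ) := by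
  have h := hu.eLpNorm_eq_integral_rpow_norm (by norm_num) (by norm_num)
  simp only [ENNReal.toReal_ofNat, Real.rpow_ofNat] at h
  rw [h, ← ENNReal.ofReal_pow (by positivity)]
  congr 1
  rw [← Real.rpow_natCast, ← Real.rpow_mul (by positivity)]
  norm_num

/-- Sequential Banach–Alaoglu, transported to the Hilbert space by the Riesz isomorphism. -/
theorem exists_subseq_tendsto_inner {E : Type*} [NormedAddCommGroup E] [InnerProductSpace ℝ E]
    [CompleteSpace E] [TopologicalSpace.SeparableSpace E] {x : ℕ → E} {C : ℝ}
    (hx : ∀ j, ‖x j‖ ≤ C) :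
    ∃ k : ℕ → ℕ, StrictMono k ∧ ∃ a : E,
      ∀ y, Tendsto (fun j => inner ℝ (x (k j)) y) atTop (𝓝 (inner ℝ a y)) := by
  obtain ⟨a, -, k, hk, ha⟩ := WeakDual.isSeqCompact_closedBall (𝕜 := ℝ) (E := E) 0 C
    (x := fun j => StrongDual.toWeakDual (InnerProductSpace.toDual ℝ E (x j)))
    (fun j => by simpa using hx j)
  refine ⟨k, hk, (InnerProductSpace.toDual ℝ E).symm (WeakDual.toStrongDual a), fun y => ?_⟩
  rw [InnerProductSpace.toDual_symm_apply]
  exact ((WeakDual.eval_continuous y).tendsto a).comp ha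

section

variable {n : ℕ} {H : Type*} [NormedAddCommGroup H] [InnerProductSpace ℝ H]
  [FiniteDimensional ℝ H]

/-- Energy estimate for a perturbed Dirac-Beltrami inequality on the whole space. -/
theorem IsWeakGrad.eLpNorm_grad_le {G : Eucl n → H} {G' : Fin n → Eucl n → H}
    (h : IsWeakGrad G G') {γp γm : Fin n → H →L[ℝ] H}
    (hp : ∀ i x y, inner ℝ (γp i x) y = inner ℝ x (γp i y))
    (hp' : ∀ i j x, γp i (γp j x) + γp j (γp i x) = if i = j then (2 : ℝ) • x else 0)
    (hm : ∀ i x y, inner ℝ (γm i x) y = -inner ℝ x (γm i y))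
    (hm' : ∀ i j x, γm i (γm j x) + γm j (γm i x) = if i = j then (-2 : ℝ) • x else 0)
    {k : ℝ≥0} (hk : k < 1) {r : Eucl n → ℝ} (hr : MemLp r 2)
    (hle : ∀ᵐ x, ‖∑ i, γm i (G' i x)‖ ≤ k * ‖∑ i, γp i (G' i x)‖ + r x) (i : Fin n) :
    eLpNorm (G' i) 2 ≤ ((1 - k)⁻¹ : ℝ≥0) * eLpNorm r 2 := by
  have ep := h.integral_norm_sq_dirac (γ := γp) (ε := 1) (by norm_num)
    (by simpa using hp) (by simpa using hp')
  have em := h.integral_norm_sq_dirac (γ := γm) (ε := -1) (by norm_num)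
    (by simpa using hm) (by simpa using hm')
  have mp : MemLp (fun x => ∑ i, γp i (G' i x)) 2 :=
    memLp_finsetSum _ fun i _ => (γp i).comp_memLp' (h.memLp_grad i)
  have mm : MemLp (fun x => ∑ i, γm i (G' i x)) 2 :=
    memLp_finsetSum _ fun i _ => (γm i).comp_memLp' (h.memLp_grad i)
  -- Both norms square to the Dirichlet energy, so the hypothesis takes the form `E ≤ k E + R`.
  have hE : eLpNorm (fun x => ∑ i, γm i (G' i x)) 2 = eLpNorm (fun x => ∑ i, γp i (G' i x)) 2 := by
    refine (ENNReal.pow_right_strictMono two_ne_zero).injective ?_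
    rw [sq_eLpNorm_two mp, sq_eLpNorm_two mm, ep, em]
  have hG : eLpNorm (G' i) 2 ≤ eLpNorm (fun x => ∑ i, γp i (G' i x)) 2 := by
    rw [← ENNReal.pow_le_pow_left_iff two_ne_zero, sq_eLpNorm_two mp,
      sq_eLpNorm_two (h.memLp_grad i), ep]
    exact ENNReal.ofReal_le_ofReal (Finset.single_le_sum
      (f := fun i => ∫ x, ‖G' i x‖ ^ 2) (fun i _ => by positivity) (Finset.mem_univ i))
  refine hG.trans ?_
  have h1 : eLpNorm (fun x => ∑ i, γm i (G' i x)) 2 ≤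
      k * eLpNorm (fun x => ∑ i, γp i (G' i x)) 2 + eLpNorm r 2 := by
    have m1 := mp.norm.const_smul (k : ℝ)
    have h2 := eLpNorm_add_le m1.1 hr.1 (p := 2) (by norm_num)
    rw [eLpNorm_const_smul, eLpNorm_norm] at h2
    rw [Real.enorm_eq_ofReal k.coe_nonneg, ENNReal.ofReal_coe_nnreal] at h2
    exact (eLpNorm_mono_ae (hle.mono fun x hx => hx.trans (le_abs_self _))).trans h2
  rw [hE] at h1
  have t1 := mp.2.ne
  have t2 := hr.2.ne
  generalize eLpNorm (fun x => ∑ i, γp i (G' i x)) 2 = E at h1 t1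
  generalize eLpNorm r 2 = R at h1 t2
  -- Absorbing `k E` on the left is legitimate only because `E` is finite.
  lift E to ℝ≥0 using t1
  lift R to ℝ≥0 using t2
  norm_cast at h1 ⊢
  have hk' : 0 < 1 - k := tsub_pos_of_lt hk
  rw [← div_eq_inv_mul, le_div_iff₀ hk', mul_tsub, mul_one, tsub_le_iff_left]
  linarith [mul_comm E k]

/-- Frequencies are split at radius `R`. On the ball the transforms are bounded by `D` and pointwise
Cauchy, so dominated convergence applies. Outside it, `|ξ|² ≥ R²` lets the gradient energy control
the rest by a multiple of `R⁻²`, uniformly in the indices. -/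
theorem tendsto_integral_norm_sub_sq {g : ℕ → Eucl n → ℂ} {g' : ℕ → Fin n → Eucl n → ℂ}
    (h : ∀ j, IsWeakGrad (g j) (g' j)) {B D : ℝ} (hB : ∀ j i, ∫ x, ‖g' j i x‖ ^ 2 ≤ B)
    (hD : ∀ j, ∫ x, ‖g j x‖ ≤ D) (hc : ∀ ξ, CauchySeq (fun j => 𝓕 (g j) ξ)) :
    Tendsto (fun p : ℕ × ℕ => ∫ x, ‖g p.1 x - g p.2 x‖ ^ 2) atTop (𝓝 0) := by
  have hs : ∀ p : ℕ × ℕ, IsWeakGrad (g p.1 - g p.2) (fun i => g' p.1 i - g' p.2 i) :=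
    fun p => (h p.1).sub (h p.2)
  have hsub : ∀ (p : ℕ × ℕ) ξ, 𝓕 (g p.1 - g p.2) ξ = 𝓕 (g p.1) ξ - 𝓕 (g p.2) ξ := by
    intro p ξ
    rw [Real.fourier_eq, Real.fourier_eq, Real.fourier_eq, ← integral_sub]
    · simp [smul_sub]
    · exact (Real.fourierIntegral_convergent_iff ξ).2 (h p.1).integrable
    · exact (Real.fourierIntegral_convergent_iff ξ).2 (h p.2).integrable
  have hsq : ∀ (p : ℕ × ℕ), Integrable (fun ξ => ‖𝓕 (g p.1 - g p.2) ξ‖ ^ 2) := fun p =>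
    (memLp_fourier (hs p).integrable (hs p).memLp).integrable_norm_pow (by norm_num)
  have hsq' : ∀ (p : ℕ × ℕ) i, Integrable (fun ξ => ‖𝓕 (g' p.1 i - g' p.2 i) ξ‖ ^ 2) := fun p i =>
    (memLp_fourier ((hs p).integrable_grad i) ((hs p).memLp_grad i)).integrable_norm_pow
      (by norm_num)
  have hB' : ∀ (p : ℕ × ℕ) i, ∫ ξ, ‖𝓕 (g' p.1 i - g' p.2 i) ξ‖ ^ 2 ≤ 4 * B := by
    intro p i
    rw [integral_norm_sq_fourier ((hs p).integrable_grad i) ((hs p).memLp_grad i)]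
    have i1 := ((h p.1).memLp_grad i).integrable_norm_pow (p := 2) (by norm_num)
    have i2 := ((h p.2).memLp_grad i).integrable_norm_pow (p := 2) (by norm_num)
    calc _ ≤ ∫ x, (2 * ‖g' p.1 i x‖ ^ 2 + 2 * ‖g' p.2 i x‖ ^ 2) := by
          refine integral_mono (((hs p).memLp_grad i).integrable_norm_pow (by norm_num))
            ((i1.const_mul 2).add (i2.const_mul 2)) fun x => ?_
          have := norm_sub_le (g' p.1 i x) (g' p.2 i x)
          simp only [Pi.sub_apply]
          nlinarith [norm_nonneg (g' p.1 i x - g' p.2 i x), sq_nonneg (‖g' p.1 i x‖ - ‖g' p.2 i x‖)]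
      _ ≤ _ := by
          rw [integral_add (i1.const_mul 2) (i2.const_mul 2), integral_const_mul,
            integral_const_mul]
          linarith [hB p.1 i, hB p.2 i]
  have hball : ∀ R : ℝ, Tendsto (fun p : ℕ × ℕ => ∫ ξ in Metric.ball 0 R,
      ‖𝓕 (g p.1 - g p.2) ξ‖ ^ 2) atTop (𝓝 0) := by
    intro R
    have := tendsto_integral_filter_of_dominated_convergence
      (μ := volume.restrict (Metric.ball (0 : Eucl n) R)) (l := (atTop : Filter (ℕ × ℕ)))
      (F := fun p ξ => ‖𝓕 (g p.1 - g p.2) ξ‖ ^ 2) (f := fun _ => 0) (fun _ => (D + D) ^ 2)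
      (Eventually.of_forall fun p => (hsq p).aestronglyMeasurable.restrict)
      (Eventually.of_forall fun p => ae_of_all _ fun ξ => ?_)
      (integrableOn_const (by simpa using measure_ball_lt_top.ne))
      (ae_of_all _ fun ξ => ?_)
    · simpa using this
    · rw [Real.norm_of_nonneg (by positivity), hsub]
      have b : ∀ j, ‖𝓕 (g j) ξ‖ ≤ D := fun j =>
        (VectorFourier.norm_fourierIntegral_le_integral_norm _ _ _ _ _).trans (hD j)
      gcongr
      exact (norm_sub_le _ _).trans (add_le_add (b _) (b _))
    · have := (cauchySeq_iff_tendsto_dist_atTop_0.1 (hc ξ)).pow 2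
      simpa [dist_eq_norm, hsub] using this
  have hmain : ∀ R : ℝ, 0 < R → ∀ p : ℕ × ℕ, ∫ x, ‖g p.1 x - g p.2 x‖ ^ 2 ≤
      (∫ ξ in Metric.ball 0 R, ‖𝓕 (g p.1 - g p.2) ξ‖ ^ 2) + (R ^ 2)⁻¹ * (n * (4 * B)) := by
    intro R hR p
    have e0 := integral_norm_sq_fourier (hs p).integrable (hs p).memLp
    simp only [Pi.sub_apply] at e0
    have i1 : Integrable (fun ξ => (Metric.ball (0 : Eucl n) R).indicator
        (fun ξ => ‖𝓕 (g p.1 - g p.2) ξ‖ ^ 2) ξ) := (hsq p).indicator measurableSet_ball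
    have i2 : Integrable (fun ξ => (R ^ 2)⁻¹ * ∑ i, ‖𝓕 (g' p.1 i - g' p.2 i) ξ‖ ^ 2) :=
      (integrable_finsetSum _ fun i _ => hsq' p i).const_mul _
    rw [← e0, ← integral_indicator measurableSet_ball]
    calc _ ≤ ∫ ξ, ((Metric.ball (0 : Eucl n) R).indicator
            (fun ξ => ‖𝓕 (g p.1 - g p.2) ξ‖ ^ 2) ξ +
            (R ^ 2)⁻¹ * ∑ i, ‖𝓕 (g' p.1 i - g' p.2 i) ξ‖ ^ 2) := by
          refine integral_mono (hsq p) (i1.add i2) fun ξ => ?_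
          simp only []
          by_cases hξ : ξ ∈ Metric.ball (0 : Eucl n) R
          · rw [Set.indicator_of_mem hξ]
            exact le_add_of_nonneg_right (by positivity)
          · rw [Set.indicator_of_notMem hξ, zero_add]
            rw [mem_ball_zero_iff, not_lt] at hξ
            have e1 : ∀ i, ‖𝓕 (g' p.1 i - g' p.2 i) ξ‖ ^ 2 =
                (2 * Real.pi) ^ 2 * (ξ i) ^ 2 * ‖𝓕 (g p.1 - g p.2) ξ‖ ^ 2 := by
              intro i
              rw [fourier_weakGrad (hs p) i ξ, norm_mul, norm_mul, Complex.norm_I,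
                Complex.norm_real, mul_one, mul_pow, Real.norm_eq_abs, sq_abs, mul_pow]
            simp only [e1, ← Finset.sum_mul, ← Finset.mul_sum]
            rw [← EuclideanSpace.real_norm_sq_eq, ← mul_assoc]
            refine le_mul_of_one_le_left (by positivity) ?_
            rw [← div_eq_inv_mul, one_le_div (by positivity)]
            have hpi : (1 : ℝ) ≤ (2 * Real.pi) ^ 2 :=
              one_le_pow₀ (by linarith [Real.pi_gt_three])
            calc R ^ 2 ≤ ‖ξ‖ ^ 2 := by gcongr
              _ ≤ _ := le_mul_of_one_le_left (by positivity) hpi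
      _ ≤ _ := by
          rw [integral_add i1 i2, integral_const_mul, integral_finsetSum _ fun i _ => hsq' p i]
          gcongr
          calc _ ≤ ∑ i : Fin n, 4 * B := Finset.sum_le_sum fun i _ => hB' p i
            _ = _ := by simp
  -- `R` is fixed first, to make the high frequencies small; the indices go to infinity afterwards.
  rw [Metric.tendsto_nhds]
  intro δ hδ
  have hR : Tendsto (fun R : ℝ => (R ^ 2)⁻¹ * (n * (4 * B))) atTop (𝓝 0) := by
    have := (tendsto_inv_atTop_zero.comp (tendsto_pow_atTop (α := ℝ) two_ne_zero)).mul_const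
      (n * (4 * B))
    simpa using this
  obtain ⟨R, hR1, hR2⟩ := ((hR.eventually_lt_const (half_pos hδ)).and (eventually_gt_atTop 0)).exists
  filter_upwards [(hball R).eventually_lt_const (half_pos hδ)] with p hp
  rw [Real.dist_0_eq_abs, abs_of_nonneg (by positivity)]
  linarith [hmain R hR2 p]

/-- Rellich's compactness theorem. -/
theorem exists_subseq_tendsto_eLpNorm_sub {G : ℕ → Eucl n → H} {G' : ℕ → Fin n → Eucl n → H}
    (h : ∀ j, IsWeakGrad (G j) (G' j)) {K : Set (Eucl n)} (hK : IsCompact K)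
    (hG : ∀ j, ∀ x ∉ K, G j x = 0) {C : ℝ≥0} (hC : ∀ j, eLpNorm (G j) 2 ≤ C)
    (hC' : ∀ j i, eLpNorm (G' j i) 2 ≤ C) :
    ∃ k : ℕ → ℕ, StrictMono k ∧
      Tendsto (fun p : ℕ × ℕ => eLpNorm (G (k p.1) - G (k p.2)) 2) atTop (𝓝 0) := by
  have : Fact ((2 : ℝ≥0∞) ≠ ⊤) := ⟨by norm_num⟩
  have hsqint : ∀ u : Eucl n → H, MemLp u 2 → eLpNorm u 2 ≤ C → ∫ x, ‖u x‖ ^ 2 ≤ C ^ 2 := by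
    intro u hu hle
    have := sq_eLpNorm_two hu
    rw [← ENNReal.ofReal_le_ofReal_iff (by positivity), ← this]
    calc _ ≤ (C : ℝ≥0∞) ^ 2 := by gcongr
      _ = _ := by rw [ENNReal.ofReal_pow (by positivity), ENNReal.ofReal_coe_nnreal]
  obtain ⟨k, hk, a, ha⟩ := exists_subseq_tendsto_inner (x := fun j => (h j).memLp.toLp (G j))
    (C := C) (fun j => by
      rw [Lp.norm_toLp]
      exact ENNReal.toReal_le_of_le_ofReal (by positivity) (by simpa using hC j))
  refine ⟨k, hk, ?_⟩
  set b := stdOrthonormalBasis ℝ H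
  set L : Fin (Module.finrank ℝ H) → H →L[ℝ] ℂ := fun s =>
    Complex.ofRealCLM ∘L innerSL ℝ (b s) with hL
  have hLn : ∀ s x, ‖L s x‖ ≤ ‖x‖ := by
    intro s x
    have := abs_real_inner_le_norm (b s) x
    simpa [hL] using this
  -- The common compact support lets `θ` be replaced by its truncation to `K`, which lies in `L²`,
  -- so weak `L²` convergence applies. With `θ` a cosine or a sine this gives pointwise convergence
  -- of the Fourier transforms.
  have hcos : ∀ s (θ : Eucl n → ℝ), Continuous θ → (∀ x, |θ x| ≤ 1) →
      CauchySeq fun j => ∫ x, θ x • L s (G (k j) x) := by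
    intro s θ hθ hθ1
    have hw : MemLp (K.indicator fun x => θ x • b s) 2 := by
      rw [memLp_indicator_iff_restrict hK.measurableSet]
      have : IsFiniteMeasure (volume.restrict K) := ⟨by simpa using hK.measure_lt_top⟩
      refine MemLp.of_bound (by fun_prop) 1 (ae_of_all _ fun x => ?_)
      rw [norm_smul, b.norm_eq_one, mul_one]
      exact hθ1 x
    have t := (ha (hw.toLp _)).cauchySeq
    have e1 : ∀ j, ∫ x, θ x • L s (G (k j) x) =
        ((inner ℝ ((h (k j)).memLp.toLp (G (k j))) (hw.toLp _) : ℝ) : ℂ) := by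
      intro j
      rw [L2.inner_def, ← integral_complex_ofReal]
      refine integral_congr_ae ?_
      filter_upwards [(h (k j)).memLp.coeFn_toLp, hw.coeFn_toLp] with x h1 h2
      rw [h1, h2]
      by_cases hx : x ∈ K
      · simp [hx, hL, inner_smul_right, real_inner_comm]
      · simp [hx, hG _ x hx]
    simp only [e1]
    exact t.map Complex.ofRealCLM.uniformContinuous
  have hscalar : ∀ s, Tendsto (fun p : ℕ × ℕ => ∫ x, ‖L s (G (k p.1) x) - L s (G (k p.2) x)‖ ^ 2)
      atTop (𝓝 0) := by
    intro s
    -- The `L¹` bound `D` comes from `t ≤ 1 + t²` integrated over `K`.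
    refine tendsto_integral_norm_sub_sq (g := fun j x => L s (G (k j) x))
      (g' := fun j i x => L s (G' (k j) i x)) (B := C ^ 2) (D := volume.real K + C ^ 2)
      (fun j => (h (k j)).clm (L s)) (fun j i => ?_) (fun j => ?_) (fun ξ => ?_)
    · refine le_trans (integral_mono (((h (k j)).clm (L s)).memLp_grad i |>.integrable_norm_pow
        (by norm_num)) (((h (k j)).memLp_grad i).integrable_norm_pow (by norm_num)) fun x => ?_)
        (hsqint _ ((h (k j)).memLp_grad i) (hC' _ i))
      simp only []
      gcongr
      exact hLn _ _
    · have i1 : Integrable (K.indicator fun _ => (1 : ℝ)) :=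
        (integrable_indicator_iff hK.measurableSet).2 (integrableOn_const hK.measure_lt_top.ne)
      have i2 := (h (k j)).memLp.integrable_norm_pow (p := 2) (by norm_num)
      calc _ ≤ ∫ x, (K.indicator (fun _ => (1 : ℝ)) x + ‖G (k j) x‖ ^ 2) := by
            refine integral_mono ((h (k j)).clm (L s)).integrable.norm (i1.add i2) fun x => ?_
            simp only []
            refine (hLn _ _).trans ?_
            by_cases hx : x ∈ K
            · simp only [hx, Set.indicator_of_mem]
              nlinarith [sq_nonneg (‖G (k j) x‖ - 1 / 2)]
            · simp [hx, hG _ x hx]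
        _ ≤ _ := by
            rw [integral_add i1 i2, integral_indicator hK.measurableSet]
            gcongr
            · simp
            · exact hsqint _ (h (k j)).memLp (hC _)
    · have e1 : ∀ j, 𝓕 (fun x => L s (G (k j) x)) ξ = _ := fun j =>
        fourier_eq_cos_sub_sin ((h (k j)).clm (L s)).integrable ξ
      simp only [e1]
      have c1 := hcos s (fun x => Real.cos (2 * Real.pi * inner ℝ x ξ)) (by fun_prop)
        fun x => Real.abs_cos_le_one _
      have c2 := (hcos s (fun x => Real.sin (2 * Real.pi * inner ℝ x ξ)) (by fun_prop)
        fun x => Real.abs_sin_le_one _).map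
          (ContinuousLinearMap.mul ℂ ℂ (-Complex.I)).uniformContinuous
      simpa [Function.comp_def, sub_eq_add_neg] using! c1.add c2
  have hsum : ∀ p : ℕ × ℕ, eLpNorm (G (k p.1) - G (k p.2)) 2 ^ 2 =
      ENNReal.ofReal (∑ s, ∫ x, ‖L s (G (k p.1) x) - L s (G (k p.2) x)‖ ^ 2) := by
    intro p
    have hs := (h (k p.1)).sub (h (k p.2))
    rw [sq_eLpNorm_two hs.memLp, ← integral_finsetSum]
    · congr 2 with x
      rw [← b.sum_sq_norm_inner_right]
      simp [hL, inner_sub_right, ← Complex.ofReal_sub]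
    · intro s _
      simp only [← map_sub]
      exact (hs.clm (L s)).memLp.integrable_norm_pow (by norm_num)
  have t2 : Tendsto (fun p : ℕ × ℕ => eLpNorm (G (k p.1) - G (k p.2)) 2 ^ 2) atTop (𝓝 0) := by
    simp only [hsum]
    have := ENNReal.tendsto_ofReal (tendsto_finsetSum Finset.univ fun s _ => hscalar s)
    simpa using this
  have t3 := ((ENNReal.continuous_rpow_const (y := 1 / 2)).tendsto 0).comp t2
  rw [ENNReal.zero_rpow_of_pos (by norm_num)] at t3
  refine t3.congr fun p => ?_
  rw [Function.comp_apply, ← ENNReal.rpow_natCast, ← ENNReal.rpow_mul]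
  norm_num

end

/-! ### Clifford relations for the symbols -/

/-- Left exterior multiplication by `e i` as a continuous linear map. -/
noncomputable def wedgeCLM {n : ℕ} (i : Fin n) : Ext n →L[ℝ] Ext n :=
  LinearMap.toContinuousLinearMap (LinearMap.mulLeft ℝ (ExteriorAlgebra.ι ℝ (e i)))

/-- Contraction by `e i` as a continuous linear map. -/
noncomputable def contractCLM {n : ℕ} (i : Fin n) : Ext n →L[ℝ] Ext n :=
  LinearMap.toContinuousLinearMap (CliffordAlgebra.contractLeft
    (Q := (0 : QuadraticForm ℝ (Eucl n))) (innerₗ (Eucl n) (e i)))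

section Clifford

variable {n : ℕ}

@[simp]
theorem wedgeCLM_apply (i : Fin n) (x : Ext n) : wedgeCLM i x = wedge i x := rfl

@[simp]
theorem contractCLM_apply (i : Fin n) (x : Ext n) : contractCLM i x = contract i x := rfl

theorem wedge_wedge_add (i j : Fin n) (x : Ext n) :
    wedge i (wedge j x) + wedge j (wedge i x) = 0 := by
  simp only [wedge, ← mul_assoc, ← add_mul]
  rw [ExteriorAlgebra.ι_add_mul_swap, zero_mul]

theorem contract_contract_add (i j : Fin n) (x : Ext n) :
    contract i (contract j x) + contract j (contract i x) = 0 := by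
  rw [contract, contract, CliffordAlgebra.contractLeft_comm, neg_add_eq_zero]
  rfl

theorem inner_contract_left (i : Fin n) (x y : Ext n) :
    inner ℝ (contract i x) y = inner ℝ x (wedge i y) := by
  rw [real_inner_comm, ← inner_wedge_left, real_inner_comm]

variable (n) in
/-- The symbol of `𝒟⁺`. -/
noncomputable def symbolPlus (i : Fin n) : Ext n →L[ℝ] Ext n := wedgeCLM i + contractCLM i

variable (n) in
/-- The symbol of `𝒟⁻`. -/
noncomputable def symbolMinus (i : Fin n) : Ext n →L[ℝ] Ext n := wedgeCLM i - contractCLM i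

theorem symbolPlus_apply (i : Fin n) (x : Ext n) :
    symbolPlus n i x = wedge i x + contract i x := rfl

theorem symbolMinus_apply (i : Fin n) (x : Ext n) :
    symbolMinus n i x = wedge i x - contract i x := rfl

theorem inner_symbolPlus (i : Fin n) (x y : Ext n) :
    inner ℝ (symbolPlus n i x) y = inner ℝ x (symbolPlus n i y) := by
  rw [symbolPlus_apply, symbolPlus_apply, inner_add_left, inner_add_right, inner_wedge_left,
    inner_contract_left, add_comm]

theorem inner_symbolMinus (i : Fin n) (x y : Ext n) :
    inner ℝ (symbolMinus n i x) y = -inner ℝ x (symbolMinus n i y) := by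
  rw [symbolMinus_apply, symbolMinus_apply, inner_sub_left, inner_sub_right, inner_wedge_left,
    inner_contract_left, neg_sub]

/-- Wedges anticommute and so do contractions, so only mixed terms survive; the antiderivation rule
`contract_wedge` contributes `x` twice on the diagonal. -/
theorem symbolPlus_anticomm (i j : Fin n) (x : Ext n) :
    symbolPlus n i (symbolPlus n j x) + symbolPlus n j (symbolPlus n i x) =
      if i = j then (2 : ℝ) • x else 0 := by
  have h1 : symbolPlus n i (symbolPlus n j x) = wedge i (wedge j x) + wedge i (contract j x) +
      (contract i (wedge j x) + contract i (contract j x)) := by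
    simp only [← wedgeCLM_apply, ← contractCLM_apply, symbolPlus, _root_.add_apply,
      map_add]
    abel
  have h2 : symbolPlus n j (symbolPlus n i x) = wedge j (wedge i x) + wedge j (contract i x) +
      (contract j (wedge i x) + contract j (contract i x)) := by
    simp only [← wedgeCLM_apply, ← contractCLM_apply, symbolPlus, _root_.add_apply,
      map_add]
    abel
  have w := wedge_wedge_add i j x
  have c := contract_contract_add i j x
  rw [h1, h2, contract_wedge, contract_wedge, eq_neg_of_add_eq_zero_left w,
    eq_neg_of_add_eq_zero_left c]
  by_cases h : i = j
  · subst h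
    simp only [if_true, two_smul]
    abel
  · simp only [h, Ne.symm h, if_false]
    abel

/-- The mixed terms now carry a minus sign, whence `-2`. -/
theorem symbolMinus_anticomm (i j : Fin n) (x : Ext n) :
    symbolMinus n i (symbolMinus n j x) + symbolMinus n j (symbolMinus n i x) =
      if i = j then (-2 : ℝ) • x else 0 := by
  have h1 : symbolMinus n i (symbolMinus n j x) = wedge i (wedge j x) - wedge i (contract j x) -
      (contract i (wedge j x) - contract i (contract j x)) := by
    simp only [← wedgeCLM_apply, ← contractCLM_apply, symbolMinus, _root_.sub_apply,
      map_sub]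
    abel
  have h2 : symbolMinus n j (symbolMinus n i x) = wedge j (wedge i x) - wedge j (contract i x) -
      (contract j (wedge i x) - contract j (contract i x)) := by
    simp only [← wedgeCLM_apply, ← contractCLM_apply, symbolMinus, _root_.sub_apply,
      map_sub]
    abel
  have w := wedge_wedge_add i j x
  have c := contract_contract_add i j x
  rw [h1, h2, contract_wedge, contract_wedge, eq_neg_of_add_eq_zero_left w,
    eq_neg_of_add_eq_zero_left c]
  by_cases h : i = j
  · subst h
    simp only [if_true, neg_smul, two_smul]
    abel
  · simp only [h, Ne.symm h, if_false]
    abel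

theorem diracPlus_eq (Ω : Set (Eucl n)) (F : Eucl n → Ext n) (x : Eucl n) :
    diracPlus Ω F x = ∑ i, symbolPlus n i (weakPartial Ω i F x) := by
  simp [diracPlus, extD, intD, symbolPlus_apply, Finset.sum_add_distrib]

theorem diracMinus_eq (Ω : Set (Eucl n)) (F : Eucl n → Ext n) (x : Eucl n) :
    diracMinus Ω F x = ∑ i, symbolMinus n i (weakPartial Ω i F x) := by
  simp [diracMinus, extD, intD, symbolMinus_apply, Finset.sum_sub_distrib]

end Clifford

/-! ### Calculus of weak partial derivatives -/

section WeakPartial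

variable {n : ℕ} {Ω U : Set (Eucl n)} {i : Fin n} {F F₁ F₂ G G₁ G₂ : Eucl n → Ext n}

theorem HasWeakPartial.mono (h : HasWeakPartial Ω i F G) (hUΩ : U ⊆ Ω) :
    HasWeakPartial U i F G := by
  refine ⟨h.1.mono_set hUΩ, h.2.1.mono_set hUΩ, fun φ hφ hc hs => ?_⟩
  have hs' : ∀ x ∉ U, fderiv ℝ φ x = 0 := fun x hx =>
    image_eq_zero_of_notMem_tsupport fun hx' => hx (hs (tsupport_fderiv_subset ℝ hx'))
  have hs0 : ∀ x ∉ U, φ x = 0 := fun x hx =>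
    image_eq_zero_of_notMem_tsupport fun hx' => hx (hs hx')
  have := h.2.2 φ hφ hc (hs.trans hUΩ)
  rw [setIntegral_eq_integral_of_forall_compl_eq_zero fun x hx => by simp [hs' x fun h => hx (hUΩ h)],
    setIntegral_eq_integral_of_forall_compl_eq_zero fun x hx => by simp [hs0 x fun h => hx (hUΩ h)]]
    at this
  rw [setIntegral_eq_integral_of_forall_compl_eq_zero fun x hx => by simp [hs' x hx],
    setIntegral_eq_integral_of_forall_compl_eq_zero fun x hx => by simp [hs0 x hx], this]

theorem integrableOn_smul_of_locallyIntegrableOn {a : Eucl n → ℝ} (ha : Continuous a)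
    (hc : HasCompactSupport a) (hs : tsupport a ⊆ Ω) {u : Eucl n → Ext n}
    (hu : LocallyIntegrableOn u Ω) : IntegrableOn (fun x => a x • u x) Ω := by
  have h1 : IntegrableOn (fun x => a x • u x) (tsupport a) :=
    (hu.integrableOn_compact_subset hs hc).continuousOn_smul ha.continuousOn hc
  exact ((integrableOn_iff_integrable_of_support_subset
    ((Function.support_smul_subset_left a u).trans (subset_tsupport a))).1 h1).integrableOn

theorem HasWeakPartial.sub (h₁ : HasWeakPartial Ω i F₁ G₁) (h₂ : HasWeakPartial Ω i F₂ G₂) :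
    HasWeakPartial Ω i (F₁ - F₂) (G₁ - G₂) := by
  refine ⟨h₁.1.sub h₂.1, h₁.2.1.sub h₂.2.1, fun φ hφ hc hs => ?_⟩
  have hc' : Continuous (fun x => fderiv ℝ φ x (e i)) :=
    (hφ.continuous_fderiv (by simp)).clm_apply continuous_const
  have hs' : tsupport (fun x => fderiv ℝ φ x (e i)) ⊆ Ω :=
    (tsupport_fderiv_apply_subset ℝ (e i)).trans hs
  have hcc : HasCompactSupport (fun x => fderiv ℝ φ x (e i)) := hc.fderiv_apply ℝ (e i)
  simp only [Pi.sub_apply, smul_sub]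
  rw [integral_sub, integral_sub, h₁.2.2 φ hφ hc hs, h₂.2.2 φ hφ hc hs]
  · abel
  · exact integrableOn_smul_of_locallyIntegrableOn hφ.continuous hc hs h₁.2.1
  · exact integrableOn_smul_of_locallyIntegrableOn hφ.continuous hc hs h₂.2.1
  · exact integrableOn_smul_of_locallyIntegrableOn hc' hcc hs' h₁.1
  · exact integrableOn_smul_of_locallyIntegrableOn hc' hcc hs' h₂.1

theorem HasWeakPartial.ae_eq (hΩ : IsOpen Ω) (h₁ : HasWeakPartial Ω i F G₁)
    (h₂ : HasWeakPartial Ω i F G₂) : G₁ =ᵐ[volume.restrict Ω] G₂ := by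
  have key := hΩ.ae_eq_zero_of_integral_contDiff_smul_eq_zero (h₁.2.1.sub h₂.2.1)
    fun φ hφ hc hs => by
      have hs0 : ∀ x ∉ Ω, φ x = 0 := fun x hx =>
        image_eq_zero_of_notMem_tsupport fun hx' => hx (hs hx')
      rw [← setIntegral_eq_integral_of_forall_compl_eq_zero (s := Ω)
        fun x hx => by simp [hs0 x hx]]
      simp only [Pi.sub_apply, smul_sub]
      rw [integral_sub, sub_eq_zero]
      · exact neg_injective ((h₁.2.2 φ hφ hc hs).symm.trans (h₂.2.2 φ hφ hc hs))
      · exact integrableOn_smul_of_locallyIntegrableOn hφ.continuous hc hs h₁.2.1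
      · exact integrableOn_smul_of_locallyIntegrableOn hφ.continuous hc hs h₂.2.1
  refine (ae_restrict_iff' hΩ.measurableSet).2 (key.mono fun x hx hxΩ => ?_)
  exact sub_eq_zero.1 (hx hxΩ)

theorem hasWeakPartial_weakPartial (h : ∃ G, HasWeakPartial Ω i F G) :
    HasWeakPartial Ω i F (weakPartial Ω i F) := by
  rw [weakPartial, dif_pos h]
  exact h.choose_spec

/-- Makes the arbitrary choice inside `weakPartial` harmless: any known weak derivative may replace
it almost everywhere. -/
theorem HasWeakPartial.weakPartial_ae_eq (hΩ : IsOpen Ω) (h : HasWeakPartial Ω i F G) :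
    weakPartial Ω i F =ᵐ[volume.restrict Ω] G :=
  (hasWeakPartial_weakPartial ⟨G, h⟩).ae_eq hΩ h

end WeakPartial

/-! ### Cutoffs and Caccioppoli's inequality -/

section Cutoff

variable {n : ℕ} {Ω : Set (Eucl n)}

theorem memLp_smul_of_restrict {a : Eucl n → ℝ} (ha : Continuous a) {K : Set (Eucl n)}
    (hK : IsCompact K) (haK : ∀ x ∉ K, a x = 0) {u : Eucl n → Ext n}
    (hu : MemLp u 2 (volume.restrict K)) : MemLp (fun x => a x • u x) 2 := by
  obtain ⟨C, hC⟩ := ha.bounded_above_of_compact_support (HasCompactSupport.intro hK haK)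
  have : (fun x => a x • u x) = K.indicator (fun x => a x • u x) := by
    ext x
    by_cases hx : x ∈ K <;> simp [hx, haK x]
  rw [this, memLp_indicator_iff_restrict hK.measurableSet]
  refine MemLp.of_le_mul (c := C) hu (ha.aestronglyMeasurable.smul hu.1) (ae_of_all _ fun x => ?_)
  rw [norm_smul]
  gcongr
  exact hC x

theorem integrable_smul_of_restrict {a : Eucl n → ℝ} (ha : Continuous a) {K : Set (Eucl n)}
    (hK : IsCompact K) (haK : ∀ x ∉ K, a x = 0) {u : Eucl n → Ext n}
    (hu : MemLp u 2 (volume.restrict K)) : Integrable (fun x => a x • u x) := by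
  have : IsFiniteMeasure (volume.restrict K) := ⟨by simpa using hK.measure_lt_top⟩
  have h1 : IntegrableOn (fun x => a x • u x) K :=
    ((memLp_smul_of_restrict ha hK haK hu).restrict K).integrable (by norm_num)
  refine (integrableOn_iff_integrable_of_support_subset fun x hx => ?_).1 h1
  by_contra h
  exact hx (by simp [haK x h])

/-- A cutoff of a function with weak derivatives in `L²_loc`. -/
theorem isWeakGrad_cutoff {φ : Eucl n → ℝ} (hφ : ContDiff ℝ ∞ φ) (hc : HasCompactSupport φ)
    (hs : tsupport φ ⊆ Ω) {F : Eucl n → Ext n} {P : Fin n → Eucl n → Ext n}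
    (hP : ∀ i, HasWeakPartial Ω i F (P i)) (hF2 : MemLp F 2 (volume.restrict (tsupport φ)))
    (hP2 : ∀ i, MemLp (P i) 2 (volume.restrict (tsupport φ))) :
    IsWeakGrad (fun x => φ x • F x) (fun i x => φ x • P i x + fderiv ℝ φ x (e i) • F x) := by
  have hc' : ∀ i, Continuous (fun x => fderiv ℝ φ x (e i)) := fun i =>
    (hφ.continuous_fderiv (by simp)).clm_apply continuous_const
  have h0 : ∀ x ∉ tsupport φ, φ x = 0 := fun x hx => image_eq_zero_of_notMem_tsupport hx
  have h0' : ∀ i, ∀ x ∉ tsupport φ, fderiv ℝ φ x (e i) = 0 := fun i x hx => by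
    rw [image_eq_zero_of_notMem_tsupport fun h => hx (tsupport_fderiv_subset ℝ h)]
    rfl
  have iF := integrable_smul_of_restrict hφ.continuous hc h0 hF2
  have iP := fun i => integrable_smul_of_restrict hφ.continuous hc h0 (hP2 i)
  have iF' := fun i => integrable_smul_of_restrict (hc' i) hc (h0' i) hF2
  refine ⟨iF, memLp_smul_of_restrict hφ.continuous hc h0 hF2, fun i => (iP i).add (iF' i),
    fun i => (memLp_smul_of_restrict hφ.continuous hc h0 (hP2 i)).add
      (memLp_smul_of_restrict (hc' i) hc (h0' i) hF2), fun i ψ hψ hb hb' => ?_⟩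
  obtain ⟨C, hC⟩ := hb
  obtain ⟨C', hC'⟩ := hb'
  have cψ' : Continuous (fun x => fderiv ℝ ψ x (e i)) :=
    (hψ.continuous_fderiv (by simp)).clm_apply continuous_const
  have j1 : Integrable (fun x => fderiv ℝ ψ x (e i) • φ x • F x) :=
    iF.bdd_smul C' cψ'.aestronglyMeasurable (ae_of_all _ hC')
  have j2 : Integrable (fun x => ψ x • fderiv ℝ φ x (e i) • F x) :=
    (iF' i).bdd_smul C hψ.continuous.aestronglyMeasurable (ae_of_all _ hC)
  have j3 : Integrable (fun x => ψ x • φ x • P i x) :=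
    (iP i).bdd_smul C hψ.continuous.aestronglyMeasurable (ae_of_all _ hC)
  have hsχ : tsupport (fun x => ψ x * φ x) ⊆ tsupport φ := tsupport_mul_subset_right
  -- Although `ψ` is only bounded, `ψ φ` is an admissible test function on `Ω`; the product rule
  -- then moves the derivative of `φ` to the other side.
  have key := (hP i).2.2 (fun x => ψ x * φ x) (hψ.mul hφ) hc.mul_left (hsχ.trans hs)
  have hd : ∀ x, fderiv ℝ (fun x => ψ x * φ x) x (e i) =
      fderiv ℝ ψ x (e i) * φ x + ψ x * fderiv ℝ φ x (e i) := by
    intro x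
    rw [fderiv_fun_mul (hψ.differentiable (by simp) x) (hφ.differentiable (by simp) x)]
    simp only [_root_.add_apply, _root_.smul_apply, smul_eq_mul]
    ring
  simp only [hd] at key
  rw [setIntegral_eq_integral_of_forall_compl_eq_zero fun x hx => by
      rw [h0 x fun h => hx (hs h), h0' i x fun h => hx (hs h)]; simp,
    setIntegral_eq_integral_of_forall_compl_eq_zero fun x hx => by
      rw [h0 x fun h => hx (hs h)]; simp] at key
  simp only [add_smul, mul_smul] at key
  simp only [smul_add]
  rw [integral_add j1 j2] at key
  rw [integral_add j3 j2, eq_sub_of_add_eq key]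
  abel

theorem exists_cutoff (hΩ : IsOpen Ω) {K : Set (Eucl n)} (hK : IsCompact K) (hKΩ : K ⊆ Ω) :
    ∃ φ : Eucl n → ℝ, ContDiff ℝ ∞ φ ∧ HasCompactSupport φ ∧ tsupport φ ⊆ Ω ∧
      (∀ᶠ x in 𝓝ˢ K, φ x = 1) ∧ ∀ x, ‖φ x‖ ≤ 1 := by
  obtain ⟨K', hK', h1, h2⟩ := exists_compact_between hK hΩ hKΩ
  obtain ⟨f, hf1, hf0, hf⟩ := exists_contMDiffMap_one_nhds_of_subset_interior (n := (⊤ : ℕ∞))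
    (modelWithCornersSelf ℝ (Eucl n)) hK.isClosed h1
  have hs : tsupport f ⊆ K' := closure_minimal (fun x hx => by
    by_contra h
    exact hx (hf0 x h)) hK'.isClosed
  refine ⟨f, f.contMDiff.contDiff, hK'.of_isClosed_subset (isClosed_tsupport _) hs,
    hs.trans h2, hf1, fun x => ?_⟩
  rw [Real.norm_of_nonneg (hf x).1]
  exact (hf x).2

/-- Caccioppoli's inequality. -/
theorem exists_caccioppoli {φ : Eucl n → ℝ} (hφ : ContDiff ℝ ∞ φ) (hc : HasCompactSupport φ)
    (hs : tsupport φ ⊆ Ω) {k : ℝ≥0} (hk : k < 1) :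
    ∃ C : ℝ≥0, ∀ (F : Eucl n → Ext n) (P : Fin n → Eucl n → Ext n),
      (∀ i, HasWeakPartial Ω i F (P i)) → MemLp F 2 (volume.restrict (tsupport φ)) →
      (∀ i, MemLp (P i) 2 (volume.restrict (tsupport φ))) →
      (∀ᵐ x ∂volume.restrict Ω,
        ‖∑ i, symbolMinus n i (P i x)‖ ≤ k * ‖∑ i, symbolPlus n i (P i x)‖) →
      ∀ i, eLpNorm (fun x => φ x • P i x + fderiv ℝ φ x (e i) • F x) 2 ≤
        C * eLpNorm F 2 (volume.restrict (tsupport φ)) := by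
  have hc' : ∀ i, Continuous (fun x => fderiv ℝ φ x (e i)) := fun i =>
    (hφ.continuous_fderiv (by simp)).clm_apply continuous_const
  have h0 : ∀ x ∉ tsupport φ, φ x = 0 := fun x hx => image_eq_zero_of_notMem_tsupport hx
  have h0' : ∀ i, ∀ x ∉ tsupport φ, fderiv ℝ φ x (e i) = 0 := fun i x hx => by
    rw [image_eq_zero_of_notMem_tsupport fun h => hx (tsupport_fderiv_subset ℝ h)]
    rfl
  choose B hB using fun i =>
    (hc' i).bounded_above_of_compact_support (HasCompactSupport.intro hc (h0' i))
  have hB0 : ∀ i, 0 ≤ B i := fun i => (norm_nonneg _).trans (hB i 0)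
  have hΓ : ∀ (γ : Fin n → Ext n →L[ℝ] Ext n) x (y : Ext n),
      ‖∑ i, γ i (fderiv ℝ φ x (e i) • y)‖ ≤ (∑ i, ‖γ i‖ * B i) * ‖y‖ := by
    intro γ x y
    rw [Finset.sum_mul]
    refine norm_sum_le_of_le _ fun i _ => ((γ i).le_opNorm _).trans ?_
    rw [norm_smul, ← mul_assoc]
    gcongr
    exact hB i x
  -- `b` bounds the commutators of both Dirac operators with multiplication by `φ`. It depends on
  -- `φ` alone, so the final constant is uniform in `F`.
  set b : ℝ := (∑ i, ‖symbolMinus n i‖ * B i) + ∑ i, ‖symbolPlus n i‖ * B i with hb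
  have hb0 : 0 ≤ b := add_nonneg
    (Finset.sum_nonneg fun i _ => mul_nonneg (norm_nonneg _) (hB0 i))
    (Finset.sum_nonneg fun i _ => mul_nonneg (norm_nonneg _) (hB0 i))
  refine ⟨(1 - k)⁻¹ * b.toNNReal, fun F P hP hF2 hP2 hle i => ?_⟩
  have hW := isWeakGrad_cutoff hφ hc hs hP hF2 hP2
  have hr : MemLp ((tsupport φ).indicator fun x => ‖F x‖) 2 := by
    rw [memLp_indicator_iff_restrict (isClosed_tsupport φ).measurableSet]
    exact hF2.norm
  have main := hW.eLpNorm_grad_le inner_symbolPlus symbolPlus_anticomm inner_symbolMinus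
    symbolMinus_anticomm hk (hr.const_smul b) ?_ i
  · refine main.trans (le_of_eq ?_)
    rw [eLpNorm_const_smul, eLpNorm_indicator_eq_eLpNorm_restrict
      (isClosed_tsupport φ).measurableSet, eLpNorm_norm, Real.enorm_eq_ofReal hb0,
      ENNReal.coe_mul, mul_assoc]
    rfl
  · have hle' : ∀ᵐ x, x ∈ tsupport φ →
        ‖∑ i, symbolMinus n i (P i x)‖ ≤ k * ‖∑ i, symbolPlus n i (P i x)‖ :=
      (ae_restrict_iff' (isClosed_tsupport φ).measurableSet).1
        (ae_restrict_of_ae_restrict_of_subset hs hle)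
    filter_upwards [hle'] with x hx
    by_cases hxs : x ∈ tsupport φ
    · have hsplit : ∀ γ : Fin n → Ext n →L[ℝ] Ext n,
          ∑ i, γ i (φ x • P i x + fderiv ℝ φ x (e i) • F x) =
          φ x • ∑ i, γ i (P i x) + ∑ i, γ i (fderiv ℝ φ x (e i) • F x) := by
        intro γ
        simp only [map_add, Finset.sum_add_distrib, Finset.smul_sum, map_smul]
      have hm := hΓ (symbolMinus n) x (F x)
      have hp := hΓ (symbolPlus n) x (F x)
      have e1 := norm_add_le (φ x • ∑ i, symbolMinus n i (P i x))
        (∑ i, symbolMinus n i (fderiv ℝ φ x (e i) • F x))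
      -- The equation controls `φ 𝒟⁻F` by `φ 𝒟⁺F`, so the commutator has to be added back to return
      -- to `𝒟⁺(φF)`; its factor `k` is dropped using `k ≤ 1`.
      have e2 := norm_le_add_norm_add (φ x • ∑ i, symbolPlus n i (P i x))
        (∑ i, symbolPlus n i (fderiv ℝ φ x (e i) • F x))
      rw [← hsplit] at e1 e2
      have e3 : ‖φ x • ∑ i, symbolMinus n i (P i x)‖ ≤
          k * ‖φ x • ∑ i, symbolPlus n i (P i x)‖ := by
        rw [norm_smul, norm_smul, mul_left_comm]
        exact mul_le_mul_of_nonneg_left (hx hxs) (norm_nonneg _)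
      have hk0 : (0 : ℝ) ≤ k := k.coe_nonneg
      have hk1 : (k : ℝ) ≤ 1 := by exact_mod_cast hk.le
      have e4 := mul_le_mul_of_nonneg_left e2 hk0
      have e5 := mul_le_of_le_one_left (norm_nonneg
        (∑ i, symbolPlus n i (fderiv ℝ φ x (e i) • F x))) hk1
      simp only [Pi.smul_apply, Set.indicator_of_mem hxs, smul_eq_mul, hb, add_mul]
      linarith
    · simp [h0 x hxs, h0' _ x hxs, hxs]

end Cutoff

/-! ### Passing to strong `L²` limits -/

theorem exists_memLp_tendsto_eLpNorm_sub {α E : Type*} [MeasurableSpace α] {μ : Measure α}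
    [NormedAddCommGroup E] [CompleteSpace E] {u : ℕ → α → E} (hu : ∀ j, MemLp (u j) 2 μ)
    (hc : Tendsto (fun p : ℕ × ℕ => eLpNorm (u p.1 - u p.2) 2 μ) atTop (𝓝 0)) :
    ∃ v, MemLp v 2 μ ∧ Tendsto (fun j => eLpNorm (u j - v) 2 μ) atTop (𝓝 0) := by
  have hcs : CauchySeq (fun j => (hu j).toLp (u j)) := by
    rw [cauchySeq_iff_tendsto_dist_atTop_0]
    have := (ENNReal.tendsto_toReal ENNReal.zero_ne_top).comp hc
    refine this.congr fun p => ?_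
    rw [dist_eq_norm, ← MemLp.toLp_sub, Lp.norm_toLp, Function.comp_apply]
  obtain ⟨v, hv⟩ := cauchySeq_tendsto_of_complete hcs
  refine ⟨v, Lp.memLp v, ?_⟩
  rw [Lp.tendsto_Lp_iff_tendsto_eLpNorm'] at hv
  refine hv.congr fun j => eLpNorm_congr_ae ?_
  filter_upwards [(hu j).coeFn_toLp] with x hx
  simp [hx]

section

variable {n : ℕ} {Ω U : Set (Eucl n)}

theorem tendsto_integral_smul_of_tendsto_eLpNorm_sub {μ : Measure (Eucl n)} {a : Eucl n → ℝ}
    (ha : MemLp a 2 μ) {u : ℕ → Eucl n → Ext n} {v : Eucl n → Ext n} (hu : ∀ j, MemLp (u j) 2 μ)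
    (hv : MemLp v 2 μ) (h : Tendsto (fun j => eLpNorm (u j - v) 2 μ) atTop (𝓝 0)) :
    Tendsto (fun j => ∫ x, a x • u j x ∂μ) atTop (𝓝 (∫ x, a x • v x ∂μ)) := by
  have hint : ∀ {w : Eucl n → Ext n}, MemLp w 2 μ → Integrable (fun x => a x • w x) μ :=
    fun hw => memLp_one_iff_integrable.1 (hw.smul ha)
  refine tendsto_integral_of_L1' _ (hint hv).1 (Eventually.of_forall fun j => hint (hu j)) ?_
  have t : Tendsto (fun j => eLpNorm a 2 μ * eLpNorm (u j - v) 2 μ) atTop (𝓝 0) := by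
    simpa using ENNReal.Tendsto.const_mul h (Or.inr ha.2.ne)
  refine tendsto_of_tendsto_of_tendsto_of_le_of_le tendsto_const_nhds t (fun _ => zero_le)
    fun j => ?_
  have e : (fun x => a x • u j x) - (fun x => a x • v x) = a • (u j - v) := by
    ext x
    simp [smul_sub]
  rw [e]
  exact eLpNorm_smul_le_mul_eLpNorm ((hu j).sub hv).1 ha.1

/-- Weak derivatives pass to `L²` limits. -/
theorem hasWeakPartial_of_tendsto {i : Fin n} {F G : ℕ → Eucl n → Ext n}
    {f g : Eucl n → Ext n} (h : ∀ j, HasWeakPartial U i (F j) (G j))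
    (hF : ∀ j, MemLp (F j) 2 (volume.restrict U)) (hG : ∀ j, MemLp (G j) 2 (volume.restrict U))
    (hf : MemLp f 2 (volume.restrict U)) (hg : MemLp g 2 (volume.restrict U))
    (hFf : Tendsto (fun j => eLpNorm (F j - f) 2 (volume.restrict U)) atTop (𝓝 0))
    (hGg : Tendsto (fun j => eLpNorm (G j - g) 2 (volume.restrict U)) atTop (𝓝 0)) :
    HasWeakPartial U i f g := by
  have hloc : ∀ {w : Eucl n → Ext n}, MemLp w 2 (volume.restrict U) → LocallyIntegrableOn w U :=
    fun hw => locallyIntegrableOn_of_locallyIntegrable_restrict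
      (hw.locallyIntegrable (by norm_num))
  refine ⟨hloc hf, hloc hg, fun φ hφ hc hs => ?_⟩
  have m1 : MemLp φ 2 (volume.restrict U) := (hφ.continuous.memLp_of_hasCompactSupport hc).restrict U
  have m2 : MemLp (fun x => fderiv ℝ φ x (e i)) 2 (volume.restrict U) :=
    (Continuous.memLp_of_hasCompactSupport
      ((hφ.continuous_fderiv (by simp)).clm_apply continuous_const)
      (hc.fderiv_apply ℝ (e i))).restrict U
  have t1 := tendsto_integral_smul_of_tendsto_eLpNorm_sub m2 hF hf hFf
  have t2 := (tendsto_integral_smul_of_tendsto_eLpNorm_sub m1 hG hg hGg).neg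
  exact tendsto_nhds_unique (t1.congr fun j => (h j).2.2 φ hφ hc hs) t2

theorem MemW12Loc.hasWeakPartial {F : Eucl n → Ext n} (h : MemW12Loc Ω F) (i : Fin n) :
    HasWeakPartial Ω i F (weakPartial Ω i F) :=
  hasWeakPartial_weakPartial ((h.2 i).imp fun _ hG => hG.1)

theorem MemW12Loc.memLp_weakPartial (hΩ : IsOpen Ω) {F : Eucl n → Ext n} (h : MemW12Loc Ω F)
    (i : Fin n) {K : Set (Eucl n)} (hK : IsCompact K) (hKΩ : K ⊆ Ω) :
    MemLp (weakPartial Ω i F) 2 (volume.restrict K) := by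
  obtain ⟨G, hG, hG2⟩ := h.2 i
  exact (memLp_congr_ae (ae_restrict_of_ae_restrict_of_subset hKΩ
    (hG.weakPartial_ae_eq hΩ))).2 (hG2 K hKΩ hK)

theorem tendstoW12_of_tendsto (hU : IsOpen U) {F : ℕ → Eucl n → Ext n} {f : Eucl n → Ext n}
    {P : ℕ → Fin n → Eucl n → Ext n} {p : Fin n → Eucl n → Ext n}
    (hP : ∀ j i, HasWeakPartial U i (F j) (P j i)) (hp : ∀ i, HasWeakPartial U i f (p i))
    (hF : ∀ j, MemLp (F j) 2 (volume.restrict U))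
    (hP2 : ∀ j i, MemLp (P j i) 2 (volume.restrict U))
    (hf : MemLp f 2 (volume.restrict U)) (hp2 : ∀ i, MemLp (p i) 2 (volume.restrict U))
    (hFf : Tendsto (fun j => eLpNorm (F j - f) 2 (volume.restrict U)) atTop (𝓝 0))
    (hPp : ∀ i, Tendsto (fun j => eLpNorm (P j i - p i) 2 (volume.restrict U)) atTop (𝓝 0)) :
    TendstoW12 U F f := by
  refine ⟨fun j => ⟨hF j, fun i => ⟨P j i, hP j i, hP2 j i⟩⟩, ⟨hf, fun i => ⟨p i, hp i, hp2 i⟩⟩, ?_⟩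
  -- `w12Norm` uses the chosen derivative of the difference, which by uniqueness is the difference
  -- of the given derivatives.
  have e1 : ∀ j i, eLpNorm (weakPartial U i (F j - f)) 2 (volume.restrict U) =
      eLpNorm (P j i - p i) 2 (volume.restrict U) := fun j i =>
    eLpNorm_congr_ae (((hP j i).sub (hp i)).weakPartial_ae_eq hU)
  simp only [w12Norm, e1]
  have sq : ∀ {w : ℕ → ℝ≥0∞}, Tendsto w atTop (𝓝 0) → Tendsto (fun j => w j ^ 2) atTop (𝓝 0) := by
    intro w hw
    simpa [Function.comp_def] using ((ENNReal.continuous_pow 2).tendsto 0).comp hw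
  have t := (sq hFf).add (tendsto_finsetSum Finset.univ fun i _ => sq (hPp i))
  have t3 := ((ENNReal.continuous_rpow_const (y := 1 / 2)).tendsto _).comp t
  simpa [Function.comp_def] using t3

/-- The residual `T` is linear in the gradient and vanishes almost everywhere on each `P j`. With
`‖M‖ ≤ 1` it is bounded in `L²`, so the norm of `T p` is at most a constant multiple of the gradient
errors, which tend to zero. -/
theorem solvesDiracBeltrami_of_tendsto (hU : IsOpen U) {M : Eucl n → Ext n →L[ℝ] Ext n}
    (hM : AEStronglyMeasurable M (volume.restrict U))
    (hM1 : ∀ᵐ x ∂volume.restrict U, ‖M x‖ ≤ 1) {f : Eucl n → Ext n}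
    {P : ℕ → Fin n → Eucl n → Ext n} {p : Fin n → Eucl n → Ext n}
    (hp : ∀ i, HasWeakPartial U i f (p i))
    (hP2 : ∀ j i, MemLp (P j i) 2 (volume.restrict U))
    (hp2 : ∀ i, MemLp (p i) 2 (volume.restrict U))
    (hPp : ∀ i, Tendsto (fun j => eLpNorm (P j i - p i) 2 (volume.restrict U)) atTop (𝓝 0))
    (hsol : ∀ j, ∀ᵐ x ∂volume.restrict U,
      ∑ i, symbolMinus n i (P j i x) = M x (∑ i, symbolPlus n i (P j i x))) :
    SolvesDiracBeltrami U M f := by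
  set T : (Fin n → Eucl n → Ext n) → Eucl n → Ext n := fun q x =>
    ∑ i, symbolMinus n i (q i x) - M x (∑ i, symbolPlus n i (q i x)) with hT
  set c : Fin n → ℝ := fun i => ‖symbolMinus n i‖ + ‖symbolPlus n i‖ with hc
  have hc0 : ∀ i, 0 ≤ c i := fun i => by positivity
  have hmeas : AEStronglyMeasurable (T p) (volume.restrict U) := by
    have m : ∀ γ : Fin n → Ext n →L[ℝ] Ext n,
        AEStronglyMeasurable (fun x => ∑ i, γ i (p i x)) (volume.restrict U) := fun γ =>
      (memLp_finsetSum _ fun i _ => (γ i).comp_memLp' (hp2 i)).1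
    exact (m _).sub
      ((ContinuousLinearMap.id ℝ (Ext n →L[ℝ] Ext n)).aestronglyMeasurable_comp₂ hM (m _))
  have hle : ∀ j, eLpNorm (T p) 2 (volume.restrict U) ≤
      ∑ i, ENNReal.ofReal (c i) * eLpNorm (P j i - p i) 2 (volume.restrict U) := by
    intro j
    have hd : ∀ i, MemLp (fun x => c i • ‖(P j i - p i) x‖) 2 (volume.restrict U) := fun i =>
      ((hP2 j i).sub (hp2 i)).norm.const_smul (c i)
    have h1 : eLpNorm (T p) 2 (volume.restrict U) ≤
        eLpNorm (∑ i, fun x => c i • ‖(P j i - p i) x‖) 2 (volume.restrict U) := by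
      refine eLpNorm_mono_ae_real ?_
      filter_upwards [hsol j, hM1] with x hx hMx
      have e1 : T p x = M x (∑ i, symbolPlus n i (P j i x - p i x)) -
          ∑ i, symbolMinus n i (P j i x - p i x) := by
        simp only [hT, map_sub, Finset.sum_sub_distrib, hx]
        abel
      rw [e1, Finset.sum_apply]
      refine (norm_sub_le _ _).trans ?_
      have e2 : ∀ γ : Fin n → Ext n →L[ℝ] Ext n, ‖∑ i, γ i (P j i x - p i x)‖ ≤
          ∑ i, ‖γ i‖ * ‖P j i x - p i x‖ := fun γ =>
        norm_sum_le_of_le _ fun i _ => (γ i).le_opNorm _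
      have e3 := ((M x).le_of_opNorm_le hMx (∑ i, symbolPlus n i (P j i x - p i x)))
      rw [one_mul] at e3
      have e4 := e2 (symbolPlus n)
      have e5 := e2 (symbolMinus n)
      simp only [hc, smul_eq_mul, add_mul, Finset.sum_add_distrib, Pi.sub_apply]
      linarith
    refine h1.trans ((eLpNorm_sum_le (fun i _ => (hd i).1) (by norm_num)).trans
      (le_of_eq (Finset.sum_congr rfl fun i _ => ?_)))
    have := eLpNorm_const_smul (c i) (fun x => ‖(P j i - p i) x‖) 2 (volume.restrict U)
    rw [eLpNorm_norm, Real.enorm_eq_ofReal (hc0 i)] at this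
    exact this
  have hlim : Tendsto (fun j => ∑ i, ENNReal.ofReal (c i) *
      eLpNorm (P j i - p i) 2 (volume.restrict U)) atTop (𝓝 0) := by
    have := tendsto_finsetSum Finset.univ fun i _ =>
      ENNReal.Tendsto.const_mul (hPp i) (Or.inr (ENNReal.ofReal_ne_top (r := c i)))
    simpa using this
  have h0 : eLpNorm (T p) 2 (volume.restrict U) = 0 :=
    le_antisymm (ge_of_tendsto' hlim hle) zero_le
  rw [eLpNorm_eq_zero_iff hmeas (by norm_num)] at h0
  have hall : ∀ᵐ x ∂volume.restrict U, ∀ i, weakPartial U i f x = p i x :=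
    ae_all_iff.2 fun i => (hp i).weakPartial_ae_eq hU
  filter_upwards [h0, hall] with x hx hpx
  rw [diracMinus_eq, diracPlus_eq]
  simp only [hpx]
  exact sub_eq_zero.1 hx

end

/-! ### Compactness of solutions -/

theorem ae_norm_le_toNNReal_eLpNorm_top {α E : Type*} [MeasurableSpace α] {μ : Measure α}
    [NormedAddCommGroup E] {f : α → E} (hf : eLpNorm f ⊤ μ ≠ ⊤) :
    ∀ᵐ x ∂μ, ‖f x‖ ≤ (eLpNorm f ⊤ μ).toNNReal := by
  filter_upwards [ae_le_eLpNormEssSup (f := f) (μ := μ)] with x hx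
  rw [← eLpNorm_exponent_top] at hx
  have := ENNReal.toNNReal_mono hf hx
  exact_mod_cast this

section

variable {n : ℕ} {Ω : Set (Eucl n)}

theorem eLpNorm_smul_le_restrict {φ : Eucl n → ℝ} (hφ1 : ∀ x, ‖φ x‖ ≤ 1) (u : Eucl n → Ext n) :
    eLpNorm (fun x => φ x • u x) 2 ≤ eLpNorm u 2 (volume.restrict (tsupport φ)) := by
  rw [← eLpNorm_indicator_eq_eLpNorm_restrict (isClosed_tsupport φ).measurableSet]
  refine eLpNorm_mono fun x => ?_
  by_cases hx : x ∈ tsupport φ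
  · rw [Set.indicator_of_mem hx, norm_smul]
    exact mul_le_of_le_one_left (norm_nonneg _) (hφ1 x)
  · simp [image_eq_zero_of_notMem_tsupport hx]

theorem eLpNorm_restrict_le_of_eqOn {K : Set (Eucl n)} (hK : MeasurableSet K)
    {u v : Eucl n → Ext n} (h : ∀ x ∈ K, u x = v x) :
    eLpNorm u 2 (volume.restrict K) ≤ eLpNorm v 2 := by
  rw [eLpNorm_congr_ae (ae_restrict_of_forall_mem hK h)]
  exact eLpNorm_restrict_le _ _ _ _

end

end DiracBeltrami

open DiracBeltrami

theorem mainTheorem1 (n : ℕ) (Ω : Set (DiracBeltrami.Eucl n)) (hΩ : IsOpen Ω)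
    (hΩb : Bornology.IsBounded Ω)
    (M : DiracBeltrami.Eucl n → DiracBeltrami.Ext n →L[ℝ] DiracBeltrami.Ext n)
    (hM : MemLp M ∞ (volume.restrict Ω)) (hM1 : eLpNorm M ∞ (volume.restrict Ω) < 1)
    (F : ℕ → DiracBeltrami.Eucl n → DiracBeltrami.Ext n)
    (hF : ∀ j, DiracBeltrami.MemW12Loc Ω (F j))
    (hsol : ∀ j, DiracBeltrami.SolvesDiracBeltrami Ω M (F j))
    (hbdd : DiracBeltrami.LocallyBoundedL2 Ω F)
    (U : Set (DiracBeltrami.Eucl n)) (hU : IsOpen U) (hUc : IsCompact (closure U))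
    (hUΩ : closure U ⊆ Ω) :
    ∃ k : ℕ → ℕ, StrictMono k ∧ ∃ FU : DiracBeltrami.Eucl n → DiracBeltrami.Ext n,
      DiracBeltrami.MemW12 U FU ∧ DiracBeltrami.SolvesDiracBeltrami U M FU ∧
        DiracBeltrami.TendstoW12 U (fun j => F (k j)) FU := by
  set κ : ℝ≥0 := (eLpNorm M ⊤ (volume.restrict Ω)).toNNReal
  have hκ : κ < 1 := by
    have := (ENNReal.toNNReal_lt_toNNReal hM.2.ne ENNReal.one_ne_top).2 hM1
    rwa [ENNReal.toNNReal_one] at this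
  have hMκ := ae_norm_le_toNNReal_eLpNorm_top hM.2.ne
  set P : ℕ → Fin n → Eucl n → Ext n := fun j i => weakPartial Ω i (F j) with hPdef
  have hP : ∀ j i, HasWeakPartial Ω i (F j) (P j i) := fun j i => (hF j).hasWeakPartial i
  have hsolP : ∀ j, ∀ᵐ x ∂volume.restrict Ω,
      ∑ i, symbolMinus n i (P j i x) = M x (∑ i, symbolPlus n i (P j i x)) := by
    intro j
    filter_upwards [hsol j] with x hx
    rwa [diracMinus_eq, diracPlus_eq] at hx
  have hle : ∀ Q : Fin n → Eucl n → Ext n, (∀ᵐ x ∂volume.restrict Ω,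
      ∑ i, symbolMinus n i (Q i x) = M x (∑ i, symbolPlus n i (Q i x))) →
      ∀ᵐ x ∂volume.restrict Ω,
        ‖∑ i, symbolMinus n i (Q i x)‖ ≤ κ * ‖∑ i, symbolPlus n i (Q i x)‖ := by
    intro Q hQ
    filter_upwards [hQ, hMκ] with x hx hMx
    rw [hx]
    exact (M x).le_of_opNorm_le hMx _
  -- Linearity of the equation: Caccioppoli's inequality will be applied to differences.
  have hsolsub : ∀ j l, ∀ᵐ x ∂volume.restrict Ω,
      ∑ i, symbolMinus n i ((P j i - P l i) x) = M x (∑ i, symbolPlus n i ((P j i - P l i) x)) := by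
    intro j l
    filter_upwards [hsolP j, hsolP l] with x h1 h2
    simp only [Pi.sub_apply, map_sub, Finset.sum_sub_distrib, h1, h2]
  -- Two nested cutoffs: `φ = 1` on the closure of `U` and `χ = 1` on the support of `φ`. Rellich
  -- for `χ F_j` gives `L²` convergence on the support of `φ`, exactly what Caccioppoli with `φ`
  -- needs to control gradients on `U`.
  obtain ⟨φ, hφ, hφc, hφΩ, hφU, hφ1⟩ := exists_cutoff hΩ hUc hUΩ
  obtain ⟨χ, hχ, hχc, hχΩ, hχφ, hχ1⟩ := exists_cutoff hΩ hφc hφΩ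
  have hF2 : ∀ j, ∀ K ⊆ Ω, IsCompact K → MemLp (F j) 2 (volume.restrict K) := fun j => (hF j).1
  have hP2 : ∀ j i, ∀ K ⊆ Ω, IsCompact K → MemLp (P j i) 2 (volume.restrict K) :=
    fun j i K hK hKc => (hF j).memLp_weakPartial hΩ i hKc hK
  -- a subsequence converging in `L²` near the support of `φ`
  obtain ⟨C₀, hC₀⟩ := hbdd _ hχΩ hχc
  obtain ⟨C₁, hC₁⟩ := exists_caccioppoli hχ hχc hχΩ hκ
  have hWχ : ∀ j, IsWeakGrad _ _ := fun j =>
    isWeakGrad_cutoff hχ hχc hχΩ (hP j) (hF2 j _ hχΩ hχc) fun i => hP2 j i _ hχΩ hχc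
  -- `C₀` bounds the functions `χ F_j`, and `C₁ * C₀` bounds their gradients.
  obtain ⟨k, hk, hkc⟩ := exists_subseq_tendsto_eLpNorm_sub hWχ hχc
    (fun j x hx => by simp [image_eq_zero_of_notMem_tsupport hx]) (C := max C₀ (C₁ * C₀))
    (fun j => ((eLpNorm_smul_le_restrict hχ1 _).trans (hC₀ j)).trans
      (by exact_mod_cast le_max_left _ _))
    (fun j i => (hC₁ (F j) (P j) (hP j) (hF2 j _ hχΩ hχc) (fun i => hP2 j i _ hχΩ hχc)
      (hle _ (hsolP j)) i).trans ((mul_le_mul_right (hC₀ j) _).trans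
        (by exact_mod_cast le_max_right _ _)))
  have hcauchy : Tendsto (fun p : ℕ × ℕ =>
      eLpNorm (F (k p.1) - F (k p.2)) 2 (volume.restrict (tsupport φ))) atTop (𝓝 0) := by
    refine tendsto_of_tendsto_of_tendsto_of_le_of_le tendsto_const_nhds hkc (fun _ => zero_le)
      fun p => eLpNorm_restrict_le_of_eqOn (isClosed_tsupport φ).measurableSet fun x hx => ?_
    simp [hχφ.self_of_nhdsSet x hx]
  -- convergence of the cut-off functions and their gradients
  obtain ⟨C₂, hC₂⟩ := exists_caccioppoli hφ hφc hφΩ hκ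
  have hWφ : ∀ j, IsWeakGrad _ _ := fun j =>
    isWeakGrad_cutoff hφ hφc hφΩ (hP j) (hF2 j _ hφΩ hφc) fun i => hP2 j i _ hφΩ hφc
  obtain ⟨f, hf, hft⟩ := exists_memLp_tendsto_eLpNorm_sub (fun j => (hWφ (k j)).memLp) (by
    refine tendsto_of_tendsto_of_tendsto_of_le_of_le tendsto_const_nhds hcauchy
      (fun _ => zero_le) fun p => ?_
    refine le_trans (le_of_eq ?_) (eLpNorm_smul_le_restrict hφ1 _)
    congr 1 with x
    simp [smul_sub])
  have hgrad : ∀ i, ∃ p : Eucl n → Ext n, MemLp p 2 ∧ Tendsto (fun j => eLpNorm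
      ((fun x => φ x • P (k j) i x + fderiv ℝ φ x (e i) • F (k j) x) - p) 2) atTop (𝓝 0) := by
    intro i
    refine exists_memLp_tendsto_eLpNorm_sub (fun j => (hWφ (k j)).memLp_grad i) ?_
    have t : Tendsto (fun p : ℕ × ℕ => (C₂ : ℝ≥0∞) *
        eLpNorm (F (k p.1) - F (k p.2)) 2 (volume.restrict (tsupport φ))) atTop (𝓝 0) := by
      simpa using ENNReal.Tendsto.const_mul hcauchy (Or.inr (ENNReal.coe_ne_top (r := C₂)))
    refine tendsto_of_tendsto_of_tendsto_of_le_of_le tendsto_const_nhds t (fun _ => zero_le)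
      fun p => ?_
    -- The second use of Caccioppoli: `L²` Cauchy on the support of `φ` becomes Cauchy for the
    -- gradients of `φ F`.
    refine le_trans (le_of_eq ?_) (hC₂ (F (k p.1) - F (k p.2))
      (fun i => P (k p.1) i - P (k p.2) i) (fun i => (hP _ i).sub (hP _ i))
      ((hF2 _ _ hφΩ hφc).sub (hF2 _ _ hφΩ hφc))
      (fun i => (hP2 _ i _ hφΩ hφc).sub (hP2 _ i _ hφΩ hφc)) (hle _ (hsolsub _ _)) i)
    congr 1 with x
    simp only [Pi.sub_apply, smul_sub]
    abel
  choose p hp hpt using hgrad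
  -- restriction to `U`
  have hUsub : U ⊆ Ω := subset_closure.trans hUΩ
  have hφU1 : ∀ x ∈ U, φ x = 1 := fun x hx => hφU.self_of_nhdsSet x (subset_closure hx)
  -- On the open set `U` the cutoff is locally constant, so there the gradient of `φ F_j` is that of
  -- `F_j`.
  have hφU0 : ∀ x ∈ U, fderiv ℝ φ x = 0 := fun x hx => by
    have : φ =ᶠ[𝓝 x] fun _ => 1 := (hU.mem_nhds hx) |> fun h => mem_of_superset h hφU1
    rw [this.fderiv_eq, fderiv_fun_const]
    rfl
  have hF2U : ∀ j, MemLp (F j) 2 (volume.restrict U) := fun j =>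
    (hF2 j _ hUΩ hUc).mono_measure (Measure.restrict_mono_set _ subset_closure)
  have hP2U : ∀ j i, MemLp (P j i) 2 (volume.restrict U) := fun j i =>
    (hP2 j i _ hUΩ hUc).mono_measure (Measure.restrict_mono_set _ subset_closure)
  have tF : Tendsto (fun j => eLpNorm (F (k j) - f) 2 (volume.restrict U)) atTop (𝓝 0) :=
    tendsto_of_tendsto_of_tendsto_of_le_of_le tendsto_const_nhds hft (fun _ => zero_le)
      fun j => eLpNorm_restrict_le_of_eqOn hU.measurableSet fun x hx => by simp [hφU1 x hx]
  have tP : ∀ i, Tendsto (fun j => eLpNorm (P (k j) i - p i) 2 (volume.restrict U))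
      atTop (𝓝 0) := fun i =>
    tendsto_of_tendsto_of_tendsto_of_le_of_le tendsto_const_nhds (hpt i) (fun _ => zero_le)
      fun j => eLpNorm_restrict_le_of_eqOn hU.measurableSet fun x hx => by
        simp [hφU1 x hx, hφU0 x hx]
  have hwp : ∀ i, HasWeakPartial U i f (p i) := fun i =>
    hasWeakPartial_of_tendsto (fun j => (hP (k j) i).mono hUsub) (fun j => hF2U _)
      (fun j => hP2U _ i) (hf.restrict U) ((hp i).restrict U) tF (tP i)
  refine ⟨k, hk, f, ⟨hf.restrict U, fun i => ⟨p i, hwp i, (hp i).restrict U⟩⟩, ?_, ?_⟩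
  · refine solvesDiracBeltrami_of_tendsto hU
      (hM.1.mono_measure (Measure.restrict_mono_set _ hUsub)) ?_ hwp (fun j => hP2U (k j))
      (fun i => (hp i).restrict U) tP
      fun j => ae_restrict_of_ae_restrict_of_subset hUsub (hsolP (k j))
    filter_upwards [ae_restrict_of_ae_restrict_of_subset hUsub hMκ] with x hx
    exact hx.trans (by exact_mod_cast hκ.le)
  · exact tendstoW12_of_tendsto hU (fun j i => (hP (k j) i).mono hUsub) hwp (fun j => hF2U _)
      (fun j => hP2U (k j)) (hf.restrict U) (fun i => (hp i).restrict U) tF tP
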